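/- **Definitions.** Let $n\ge 2$ be an integer. A *partial affine plane* (PAP) of order $n$ is a pair $(\mathcal S,\mathcal A)$ where $\mathcal S$ is a set of $n^2$ points and $\mathcal A$ is a set of lines (subsets of $\mathcal S$), such that each line has exactly $n$ points and any two distinct lines meet in at most one point. Two lines are *parallel* if they coincide or have no point in common. An *affine plane* is a pair $(\mathcal S,\mathcal A')$ of points and lines (subsets of $\mathcal S$) such that through any two distinct points there is a unique line, for any line $\ell$ and any point $P\notin\ell$ there is a unique line through $P$ disjoint from $\ell$, and there exist three points that are not collinear; it has *order* $n$ if it has $n^2$ points and $n$ points on each line. A PAP $(\mathcal S,\mathcal A)$ of order $n$ *can be completed to an affine plane* if there is an affine plane $(\mathcal S,\mathcal A')$ of order $n$ on the same point set with $\mathcal A\subseteq\mathcal A'$. Let $g(n)=\min\{g_1(n),g_2(n),g_3(n),g_4(n)\}$, where $$g_1(n)=n^2-1,\qquad g_2(n)=n^2-2\sqrt{n+3}+6,\qquad g_3(n)=n^2-\frac n6,\qquad g_4(n)=n^2-\frac{\sqrt5-1}{2}\,n+\frac{17}{\sqrt5}\sqrt n+1 .$$ **Theorem.** Let $(\mathcal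 S,\mathcal A)$ be a PAP of order $n\ge 2$ with $b$ lines. Suppose that parallelism is an equivalence relation on $\mathcal A$, and that $b=n^2-a$ with $$1\le a<\min\bigl(\sqrt n,\; n^2-g(n)+1\bigr).$$ Then $(\mathcal S,\mathcal A)$ can be completed to an affine plane. -/

import Mathlib

/-- A partial affine plane of order `n ≥ 2`: a set of `n ^ 2` points, and a set `A` of lines (subsets
of the point set), such that each line has `n` points and any two distinct lines meet in at most one
point. -/
structure IsPartialAffinePlane {P : Type*} [Fintype P] [DecidableEq P]
    (n : ℕ) (A : Finset (Finset P)) : Prop where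
  two_le_order : 2 ≤ n
  card_points : Fintype.card P = n ^ 2
  card_line : ∀ l ∈ A, l.card = n
  card_inter_le_one : ∀ l ∈ A, ∀ m ∈ A, l ≠ m → (l ∩ m).card ≤ 1

/-- Two lines are parallel if they coincide or have no point in common. -/
def LinesParallel {P : Type*} (l m : Finset P) : Prop :=
  l = m ∨ Disjoint l m

/-- Parallelism is an equivalence relation on the set `A` of lines. -/
def ParallelismIsEquivalence {P : Type*} (A : Finset (Finset P)) : Prop :=
  Equivalence fun l m : {l : Finset P // l ∈ A} => LinesParallel l.1 m.1

/-- An affine plane, as a set `A` of lines on the point set `P`. -/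
structure IsAffinePlane {P : Type*} (A : Finset (Finset P)) : Prop where
  exists_unique_line : ∀ p q : P, p ≠ q → ∃! l : Finset P, l ∈ A ∧ p ∈ l ∧ q ∈ l
  exists_unique_parallel : ∀ l ∈ A, ∀ p : P, p ∉ l →
    ∃! m : Finset P, m ∈ A ∧ p ∈ m ∧ Disjoint m l
  exists_noncollinear : ∃ p q r : P, p ≠ q ∧ p ≠ r ∧ q ≠ r ∧
    ¬ ∃ l ∈ A, p ∈ l ∧ q ∈ l ∧ r ∈ l

/-- An affine plane of order `n`: an affine plane with `n ^ 2` points and `n` points on each line. -/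
structure IsAffinePlaneOfOrder {P : Type*} [Fintype P]
    (n : ℕ) (A : Finset (Finset P)) : Prop extends IsAffinePlane A where
  card_points : Fintype.card P = n ^ 2
  card_line : ∀ l ∈ A, l.card = n

/-- The set `A` of lines can be completed to an affine plane of order `n` on the same points. -/
def CanBeCompletedToAffinePlane {P : Type*} [Fintype P]
    (n : ℕ) (A : Finset (Finset P)) : Prop :=
  ∃ A' : Finset (Finset P), A ⊆ A' ∧ IsAffinePlaneOfOrder n A'

noncomputable section

def gOne (n : ℕ) : ℝ := (n : ℝ) ^ 2 - 1

def gTwo (n : ℕ) : ℝ := (n : ℝ) ^ 2 - 2 * Real.sqrt ((n : ℝ) + 3) + 6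

def gThree (n : ℕ) : ℝ := (n : ℝ) ^ 2 - (n : ℝ) / 6

def gFour (n : ℕ) : ℝ :=
  (n : ℝ) ^ 2 - (Real.sqrt 5 - 1) / 2 * (n : ℝ) + 17 / Real.sqrt 5 * Real.sqrt (n : ℝ) + 1

/-- The bound `g = min(g₁, g₂, g₃, g₄)`. -/
def gMin (n : ℕ) : ℝ := min (min (gOne n) (gTwo n)) (min (gThree n) (gFour n))

end

open Finset

/-! The partial affine plane is embedded in a partial projective plane, which is completed one line
at a time; removing the ideal line then gives the affine plane.

The embedding needs at most `n + 1` parallel classes (`card_parallelClasses_le`). With more, no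
point would lie on more than `n` lines, and a second-moment count of the deficiencies of points and
classes contradicts `a ^ 2 < n`. Each class gets its own ideal point and the ideal line is added, so
that `N = n + a` lines are missing.

Let the defect `d` of a point be the number of lines it lacks. It has `n * d` points unjoined to it,
and any line off it carries exactly `d` of them. A point with `d = 1`, together with its unjoined
points, is therefore a new line. If no defect is 1, then `∑ d * (d - 2) = N * (N - n - 2)` is
nonnegative, so `N = n + 2 + t`, and points with `d = 2` exist. On the `2 * n` points unjoined to
such a point `p`, join two when they share a line. If this graph is bipartite with sides of size
`n`, then `p` with either side is a new line, since a line off `p` contains exactly two of these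
points, one on each side.

Bipartiteness (`exists_bipartition`) is a stability argument. With excess `e = d - 2`, degrees are
`n - 1 - e`, the excesses sum to `2 * t`, and adjacent vertices have at most `(1 + e u) * (1 + e v)`
common neighbours. For `t` small against `n`, the graph is so close to complete bipartite minus a
matching that no edge can lie inside a side. `FewMissing` records the bounds required and persists
as lines are added. -/

theorem card_excess_pos_add_le {V : Type*} [DecidableEq V] {e : V → ℕ} (S : Finset V) {v : V} (hv : v ∈ S) :
    (S.filter (e · ≠ 0)).card + e v ≤ (∑ w ∈ S, e w) + 1 := by
  rw [card_filter, ← add_sum_erase _ _ hv, ← add_sum_erase S e hv]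
  have : ∑ x ∈ S.erase v, (if e x ≠ 0 then 1 else 0) ≤ ∑ x ∈ S.erase v, e x := by
    apply sum_le_sum; intro x _; split_ifs <;> omega
  split_ifs <;> omega

theorem card_excess_pos_add_add_le {V : Type*} [DecidableEq V] {e : V → ℕ} (S : Finset V) {u v : V} (hu : u ∈ S) (hv : v ∈ S)
    (huv : u ≠ v) :
    (S.filter (e · ≠ 0)).card + e u + e v ≤ (∑ w ∈ S, e w) + 2 := by
  rw [card_filter, ← add_sum_erase _ _ hv, ← add_sum_erase S e hv]
  have hu' : u ∈ S.erase v := mem_erase.2 ⟨huv, hu⟩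
  rw [← add_sum_erase _ _ hu', ← add_sum_erase _ e hu']
  have : ∑ x ∈ (S.erase v).erase u, (if e x ≠ 0 then 1 else 0) ≤
      ∑ x ∈ (S.erase v).erase u, e x := by
    apply sum_le_sum; intro x _; split_ifs <;> omega
  split_ifs <;> omega

/-! ### Bipartiteness of nearly regular graphs with few common neighbours. -/

section Bipartition

variable {V : Type*} [Fintype V] [DecidableEq V] {H : SimpleGraph V} [DecidableRel H.Adj]
  {n t : ℕ} {e : V → ℕ}

theorem card_add_card_add_card_le (A B C : Finset V) :
    A.card + B.card + C.card ≤
      Fintype.card V + (A ∩ B).card + (A ∩ C).card + (B ∩ C).card := by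
  have h1 := card_union_add_card_inter A B
  have h2 := card_union_add_card_inter (A ∪ B) C
  have h3 : ((A ∪ B) ∩ C).card ≤ (A ∩ C).card + (B ∩ C).card := by
    rw [union_inter_distrib_right]; exact card_union_le _ _
  have h4 : (A ∪ B ∪ C).card ≤ Fintype.card V := card_le_univ _
  omega

/-- There is no triangle two of whose vertices have excess zero. -/
theorem no_triangle_of_excess_zero (hV : Fintype.card V = 2 * n)
    (hdeg : ∀ v, (H.neighborFinset v).card + e v + 1 = n)
    (htri : ∀ u v, H.Adj u v →
      (H.neighborFinset u ∩ H.neighborFinset v).card ≤ (1 + e u) * (1 + e v))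
    (he : ∀ v, 3 * e v + 6 < n) {u v w : V} (hu : e u = 0) (hv : e v = 0)
    (huv : H.Adj u v) (huw : H.Adj u w) (hvw : H.Adj v w) : False := by
  -- The degrees sum to `3n - 3 - e w`, while inclusion-exclusion allows at most `2n + 1 + 2(1 + e
  -- w)`. So `n ≤ 3 e w + 6`, which is exactly what `he` forbids.
  have h := card_add_card_add_card_le (H.neighborFinset u) (H.neighborFinset v)
    (H.neighborFinset w)
  have h1 := htri u v huv
  have h2 := htri u w huw
  have h3 := htri v w hvw
  rw [hu, hv] at h1
  rw [hu] at h2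
  rw [hv] at h3
  have := hdeg u
  have := hdeg v
  have := hdeg w
  have := he w
  omega

/-- The vertices fall into two sides, such that edges inside a side only join vertices of positive
excess. -/
theorem exists_sides (hV : Fintype.card V = 2 * n)
    (hdeg : ∀ v, (H.neighborFinset v).card + e v + 1 = n) (hsum : ∑ v, e v = 2 * t)
    (htri : ∀ u v, H.Adj u v →
      (H.neighborFinset u ∩ H.neighborFinset v).card ≤ (1 + e u) * (1 + e v))
    (he : ∀ v, 3 * e v + 6 < n) (hnt : 6 * t + 6 ≤ n) :
    ∃ X : Finset V, (∀ u ∈ X, ∀ v ∈ X, H.Adj u v → e u ≠ 0) ∧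
      (∀ u ∈ Xᶜ, ∀ v ∈ Xᶜ, H.Adj u v → e u ≠ 0) ∧
      (∃ x ∈ X, e x = 0) ∧ ∃ y ∈ Xᶜ, e y = 0 := by
  have T := @no_triangle_of_excess_zero V _ _ H _ n e hV hdeg htri he
  set Z : Finset V := univ.filter (e · ≠ 0) with hZ
  have hZe : ∀ v, Z.card + e v ≤ 2 * t + 1 := fun v ↦ by
    have := card_excess_pos_add_le (e := e) univ (mem_univ v)
    rwa [hsum] at this
  have memZ : ∀ v, v ∉ Z → e v = 0 := fun v hv ↦ by simpa [hZ] using hv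
  have hZ2 : Z.card ≤ 2 * t := by
    rw [← hsum, hZ, card_filter]
    apply sum_le_sum; intro x _; split_ifs <;> omega
  obtain ⟨x, -, hx⟩ : ∃ x ∈ univ, x ∉ Z := exists_mem_notMem_of_card_lt_card (by
    rw [card_univ]; omega)
  have hx0 := memZ x hx
  obtain ⟨y, hxy, hy⟩ : ∃ y ∈ H.neighborFinset x, y ∉ Z := exists_mem_notMem_of_card_lt_card (by
    have := hdeg x; omega)
  have hy0 := memZ y hy
  rw [SimpleGraph.mem_neighborFinset] at hxy
  -- The neighbourhoods of the ends of an edge of excess zero are disjoint and cover all but two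
  -- vertices; they approximate the two sides. `A q` and `B q` are the neighbours of `q` of excess
  -- zero in each.
  set X₁ := H.neighborFinset y with hX₁
  set Y₁ := H.neighborFinset x with hY₁
  have hX₁c : X₁.card + 1 = n := by rw [hX₁]; have := hdeg y; omega
  have hY₁c : Y₁.card + 1 = n := by rw [hY₁]; have := hdeg x; omega
  set R : Finset V := (X₁ ∪ Y₁)ᶜ with hR
  have hdisj : Disjoint X₁ Y₁ := by
    rw [disjoint_left]
    intro v hv hv'
    simp only [hX₁, hY₁, SimpleGraph.mem_neighborFinset] at hv hv'
    exact T hx0 hy0 hxy hv' hv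
  have hRc : R.card ≤ 2 := by
    rw [hR, card_compl, card_union_of_disjoint hdisj, hV]; omega
  let A : V → Finset V := fun q ↦ (H.neighborFinset q ∩ X₁) \ Z
  let B : V → Finset V := fun q ↦ (H.neighborFinset q ∩ Y₁) \ Z
  have memA : ∀ q a, a ∈ A q ↔ (H.Adj q a ∧ H.Adj y a) ∧ a ∉ Z := fun q a ↦ by
    simp [A, hX₁]
  have memB : ∀ q a, a ∈ B q ↔ (H.Adj q a ∧ H.Adj x a) ∧ a ∉ Z := fun q a ↦ by
    simp [B, hY₁]
  have hcover : ∀ q, H.neighborFinset q ⊆ (A q ∪ B q) ∪ ((R.erase q) ∪ Z) := by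
    intro q v hv
    have hvq : v ≠ q := by
      rintro rfl; simp at hv
    simp only [A, B, mem_union, mem_sdiff, mem_inter, mem_erase, hR, mem_compl]
    tauto
  -- a vertex of excess zero sees at most its opposite side and the rest
  have hBsmall : ∀ q, ∀ a ∈ A q, (B q).card ≤ 2 := by
    intro q a ha
    obtain ⟨⟨hqa, hya⟩, haZ⟩ := (memA q a).1 ha
    have ha0 := memZ a haZ
    have hsub : H.neighborFinset a ⊆ (Y₁ \ B q) ∪ R := by
      intro v hv
      rw [SimpleGraph.mem_neighborFinset] at hv
      have h1 : v ∉ X₁ := fun h ↦ T hy0 ha0 hya (by simpa [hX₁] using h) hv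
      have h2 : v ∉ B q := fun h ↦ by
        obtain ⟨⟨hqv, -⟩, hvZ⟩ := (memB q v).1 h
        exact T ha0 (memZ v hvZ) hv hqa.symm hqv.symm
      simp only [hR, mem_union, mem_sdiff, mem_compl]
      tauto
    have h1 := (card_le_card hsub).trans (card_union_le _ _)
    have h2 : B q ⊆ Y₁ := sdiff_subset.trans inter_subset_right
    have h3 := card_sdiff_add_card_eq_card h2
    have := hdeg a
    omega
  have hAsmall : ∀ q, ∀ b ∈ B q, (A q).card ≤ 2 := by
    intro q b hb
    obtain ⟨⟨hqb, hxb⟩, hbZ⟩ := (memB q b).1 hb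
    have hb0 := memZ b hbZ
    have hsub : H.neighborFinset b ⊆ (X₁ \ A q) ∪ R := by
      intro v hv
      rw [SimpleGraph.mem_neighborFinset] at hv
      have h1 : v ∉ Y₁ := fun h ↦ T hx0 hb0 hxb (by simpa [hY₁] using h) hv
      have h2 : v ∉ A q := fun h ↦ by
        obtain ⟨⟨hqv, -⟩, hvZ⟩ := (memA q v).1 h
        exact T hb0 (memZ v hvZ) hv hqb.symm hqv.symm
      simp only [hR, mem_union, mem_sdiff, mem_compl]
      tauto
    have h1 := (card_le_card hsub).trans (card_union_le _ _)
    have h2 : A q ⊆ X₁ := sdiff_subset.trans inter_subset_right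
    have h3 := card_sdiff_add_card_eq_card h2
    have := hdeg b
    omega
  have hbound : ∀ q, n ≤ 1 + e q + (A q).card + (B q).card + (R.erase q).card + Z.card := by
    intro q
    have h1 := card_le_card (hcover q)
    have h2 := card_union_le (A q ∪ B q) ((R.erase q) ∪ Z)
    have h3 := card_union_le (A q) (B q)
    have h4 := card_union_le (R.erase q) Z
    have := hdeg q
    omega
  have hRe : ∀ q, (R.erase q).card ≤ 2 := fun q ↦ (card_le_card (erase_subset _ _)).trans hRc
  have hnotboth : ∀ q a b, a ∈ A q → b ∈ B q → False := by
    intro q a b ha hb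
    have h1 := hBsmall q a ha
    have h2 := hAsmall q b hb
    have h3 := hbound q
    have h4 := hZe q
    have h5 := hRe q
    have h6 := he q
    -- So far `n ≤ 2t + 8`, against `6t + 6 ≤ n`. If `q ∈ Z` then `t ≥ 1` and this fails. Otherwise
    -- `q` itself lies in `R`, which improves the bound to `n ≤ 2t + 6`; only `t = 0`, `n = 6` is
    -- left, and `he` excludes it.
    by_cases hq : q ∈ Z
    · have : 0 < Z.card := card_pos.2 ⟨q, hq⟩
      omega
    · have hq0 := memZ q hq
      obtain ⟨⟨hqa, hya⟩, haZ⟩ := (memA q a).1 ha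
      obtain ⟨⟨hqb, hxb⟩, hbZ⟩ := (memB q b).1 hb
      have hqR : q ∈ R := by
        simp only [hR, mem_compl, mem_union, hX₁, hY₁, SimpleGraph.mem_neighborFinset]
        rintro (h | h)
        · exact T hy0 hq0 h hya hqa
        · exact T hx0 hq0 h hxb hqb
      have := card_erase_of_mem hqR
      omega
  have hnotempty : ∀ q, A q = ∅ → B q = ∅ → False := by
    intro q ha hb
    have h3 := hbound q
    rw [ha, hb, card_empty] at h3
    have h4 := hZe q
    have h5 := hRe q
    have h6 := he q
    omega
  have hAe : ∀ q b, b ∈ B q → A q = ∅ := fun q b hb ↦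
    eq_empty_of_forall_notMem fun a ha ↦ hnotboth q a b ha hb
  have hBe : ∀ q a, a ∈ A q → B q = ∅ := fun q a ha ↦
    eq_empty_of_forall_notMem fun b hb ↦ hnotboth q a b ha hb
  have hxX : A x = ∅ := hAe x y ((memB x y).2 ⟨⟨hxy, hxy⟩, hy⟩)
  have hyY : A y ≠ ∅ := ne_empty_of_mem ((memA y x).2 ⟨⟨hxy.symm, hxy.symm⟩, hx⟩)
  -- For every `q` exactly one of `A q`, `B q` is nonempty, and this decides the side of `q`. Two
  -- adjacent vertices on the same side, one of excess zero, would have disjoint and nearly full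
  -- traces on the same set of `n - 1` vertices.
  refine ⟨univ.filter (A · = ∅), ?_, ?_, ⟨x, by simpa using hxX, hx0⟩, ⟨y, by simpa using hyY, hy0⟩⟩
  · intro u hu v hv huv hu0
    simp only [mem_filter, mem_univ, true_and] at hu hv
    have hb1 := hbound u
    have hb2 := hbound v
    have hd : Disjoint (B u) (B v) := by
      rw [disjoint_left]
      intro b hb hb'
      obtain ⟨⟨hub, -⟩, hbZ⟩ := (memB u b).1 hb
      obtain ⟨⟨hvb, -⟩, -⟩ := (memB v b).1 hb'
      exact T hu0 (memZ b hbZ) hub huv hvb.symm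
    have hs : B u ∪ B v ⊆ Y₁ := union_subset (sdiff_subset.trans inter_subset_right)
      (sdiff_subset.trans inter_subset_right)
    have h := card_le_card hs
    rw [card_union_of_disjoint hd] at h
    rw [hu, card_empty] at hb1
    rw [hv, card_empty] at hb2
    have := hZe v
    have := hRe u
    have := hRe v
    have := he u
    omega
  · intro u hu v hv huv hu0
    simp only [mem_compl, mem_filter, mem_univ, true_and] at hu hv
    obtain ⟨a, ha⟩ := nonempty_iff_ne_empty.2 hu
    obtain ⟨a', ha'⟩ := nonempty_iff_ne_empty.2 hv
    have hb1 := hbound u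
    have hb2 := hbound v
    have hd : Disjoint (A u) (A v) := by
      rw [disjoint_left]
      intro b hb hb'
      obtain ⟨⟨hub, -⟩, hbZ⟩ := (memA u b).1 hb
      obtain ⟨⟨hvb, -⟩, -⟩ := (memA v b).1 hb'
      exact T hu0 (memZ b hbZ) hub huv hvb.symm
    have hs : A u ∪ A v ⊆ X₁ := union_subset (sdiff_subset.trans inter_subset_right)
      (sdiff_subset.trans inter_subset_right)
    have h := card_le_card hs
    rw [card_union_of_disjoint hd] at h
    rw [hBe u a ha, card_empty] at hb1
    rw [hBe v a' ha', card_empty] at hb2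
    have := hZe v
    have := hRe u
    have := hRe v
    have := he u
    omega

/-- The number of common neighbours bounds the size of a side that contains an edge. -/
theorem le_of_edge_in_side
    (hdeg : ∀ v, (H.neighborFinset v).card + e v + 1 = n)
    (htri : ∀ u v, H.Adj u v →
      (H.neighborFinset u ∩ H.neighborFinset v).card ≤ (1 + e u) * (1 + e v))
    {X : Finset V} (hX : ∀ u ∈ X, ∀ v ∈ X, H.Adj u v → e u ≠ 0)
    {u v : V} (hu : u ∈ X) (hv : v ∈ X) (huv : H.Adj u v) :
    8 * n ≤ 16 + 4 * Xᶜ.card + 4 * ∑ w ∈ X, e w + (2 + ∑ w ∈ X, e w) ^ 2 := by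
  have h1 := card_excess_pos_add_add_le (e := e) X hu hv huv.ne
  have hsub : ∀ w ∈ X, H.neighborFinset w ⊆ Xᶜ ∪ X.filter (e · ≠ 0) := by
    intro w hw z hz
    rw [SimpleGraph.mem_neighborFinset] at hz
    simp only [mem_union, mem_compl, mem_filter]
    by_cases hzX : z ∈ X
    · exact Or.inr ⟨hzX, hX z hzX w hw hz.symm⟩
    · exact Or.inl hzX
  -- The terms `e u + e v` in the degrees cancel against those in `h1`, leaving `2n ≤ 4 + |Xᶜ| + ∑ e
  -- + (1 + e u)(1 + e v)`. The product is then bounded by AM-GM.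
  have h2 := card_le_card (union_subset (hsub u hu) (hsub v hv))
  have h3 := card_union_le Xᶜ (X.filter (e · ≠ 0))
  have h4 := card_union_add_card_inter (H.neighborFinset u) (H.neighborFinset v)
  have h5 := htri u v huv
  have h6 := hdeg u
  have h7 := hdeg v
  have h8 : 0 < e u := Nat.pos_of_ne_zero (hX u hu v hv huv)
  have h9 : 0 < e v := Nat.pos_of_ne_zero (hX v hv u hu huv.symm)
  have h10 : e u + e v ≤ ∑ w ∈ X, e w := by
    rw [← sum_pair huv.ne]
    exact sum_le_sum_of_subset (by intro z; simp; rintro (rfl | rfl) <;> assumption)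
  have h11 : 4 * ((1 + e u) * (1 + e v)) ≤ (2 + ∑ w ∈ X, e w) ^ 2 := by
    calc 4 * ((1 + e u) * (1 + e v)) ≤ (2 + (e u + e v)) ^ 2 := by
          zify; nlinarith [sq_nonneg ((e u : ℤ) - e v)]
      _ ≤ _ := by gcongr
  omega

theorem sum_card_inter_compl (X : Finset V) :
    ∑ v ∈ X, (H.neighborFinset v ∩ Xᶜ).card = ∑ v ∈ Xᶜ, (H.neighborFinset v ∩ X).card := by
  have h := sum_card_bipartiteAbove_eq_sum_card_bipartiteBelow (s := X) (t := Xᶜ) H.Adj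
  convert h using 2 with v _ v _
  · congr 1; ext w; simp [bipartiteAbove, and_comm]
  · congr 1; ext w; simp [bipartiteBelow, and_comm, H.adj_comm]

/-- The sides from `exists_sides` have sizes within one of `n`. Edges across are counted from both
ends: the count rules out unequal sides, and with equal sides an edge inside one would force more
than half of the total excess into it, unbalancing the count. -/
theorem exists_bipartition (hV : Fintype.card V = 2 * n)
    (hdeg : ∀ v, (H.neighborFinset v).card + e v + 1 = n) (hsum : ∑ v, e v = 2 * t)
    (htri : ∀ u v, H.Adj u v →
      (H.neighborFinset u ∩ H.neighborFinset v).card ≤ (1 + e u) * (1 + e v))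
    (he : ∀ v, 3 * e v + 6 < n) (hnt : 6 * t + 6 ≤ n) (hsq : (t + 2) ^ 2 < n) :
    ∃ X : Finset V, X.card = n ∧ ∀ u v, H.Adj u v → (u ∈ X ↔ v ∉ X) := by
  obtain ⟨X, hX, hY, ⟨x, hx, hx0⟩, ⟨y, hy, hy0⟩⟩ := exists_sides hV hdeg hsum htri he hnt
  have hcard := card_add_card_compl X
  rw [hV] at hcard
  have hYl : n ≤ Xᶜ.card + 1 := by
    have h : H.neighborFinset x ⊆ Xᶜ := by
      intro v hv
      rw [SimpleGraph.mem_neighborFinset] at hv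
      rw [mem_compl]
      exact fun h ↦ hX x hx v h hv hx0
    have := card_le_card h
    have := hdeg x
    omega
  have hXl : n ≤ X.card + 1 := by
    have h : H.neighborFinset y ⊆ X := by
      intro v hv
      rw [SimpleGraph.mem_neighborFinset] at hv
      by_contra h
      exact hY y hy v (mem_compl.2 h) hv hy0
    have := card_le_card h
    have := hdeg y
    omega
  have hes : ∑ v ∈ X, e v + ∑ v ∈ Xᶜ, e v = 2 * t := by rw [sum_add_sum_compl, hsum]
  have hEX := fun u hu v hv h ↦ le_of_edge_in_side hdeg htri hX (u := u) (v := v) hu hv h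
  have hEY := fun u hu v hv h ↦ le_of_edge_in_side hdeg htri hY (u := u) (v := v) hu hv h
  rw [compl_compl] at hEY
  have key : ∀ S : Finset V, S.card * n = S.card + ∑ v ∈ S, e v +
      ∑ v ∈ S, (H.neighborFinset v ∩ S).card + ∑ v ∈ S, (H.neighborFinset v ∩ Sᶜ).card := by
    intro S
    rw [← smul_eq_mul, ← sum_const, card_eq_sum_ones, ← sum_add_distrib, ← sum_add_distrib,
      ← sum_add_distrib]
    refine sum_congr rfl fun v _ ↦ ?_
    have := hdeg v
    have h := card_inter_add_card_sdiff (H.neighborFinset v) S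
    rw [sdiff_eq_inter_compl] at h
    omega
  have kX := key X
  have kY := key Xᶜ
  rw [compl_compl, ← sum_card_inter_compl] at kY
  have hI : ∀ S : Finset V, (∀ u ∈ S, ∀ v ∈ S, ¬ H.Adj u v) →
      ∑ v ∈ S, (H.neighborFinset v ∩ S).card = 0 := by
    intro S hS
    refine sum_eq_zero fun v hv ↦ ?_
    rw [card_eq_zero]
    refine eq_empty_of_forall_notMem fun w hw ↦ ?_
    rw [mem_inter, SimpleGraph.mem_neighborFinset] at hw
    exact hS v hv w hw.2 hw.1
  set sX := ∑ v ∈ X, e v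
  set sY := ∑ v ∈ Xᶜ, e v
  have hcases : X.card = n ∧ Xᶜ.card = n ∨ X.card = n + 1 ∧ Xᶜ.card + 1 = n ∨
      X.card + 1 = n ∧ Xᶜ.card = n + 1 := by omega
  rcases hcases with ⟨h1, h2⟩ | ⟨h1, h2⟩ | ⟨h1, h2⟩
  -- As `sX + sY = 2 * t`, at most one side can contain an edge. But `sX` plus its inner degrees
  -- equals `sY` plus its inner degrees, so the side with the larger excess cannot be that one.
  · have hXt : (∃ u ∈ X, ∃ v ∈ X, H.Adj u v) → t < sX := by
      rintro ⟨u, hu, v, hv, h⟩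
      have := hEX u hu v hv h
      by_contra! hlt
      have : (2 + sX) ^ 2 ≤ (2 + t) ^ 2 := by gcongr
      nlinarith
    have hYt : (∃ u ∈ Xᶜ, ∃ v ∈ Xᶜ, H.Adj u v) → t < sY := by
      rintro ⟨u, hu, v, hv, h⟩
      have := hEY u hu v hv h
      by_contra! hlt
      have : (2 + sY) ^ 2 ≤ (2 + t) ^ 2 := by gcongr
      nlinarith
    have hXno : ∀ u ∈ X, ∀ v ∈ X, ¬ H.Adj u v := by
      by_contra! hcon
      have h3 := hXt hcon
      have h4 := hI Xᶜ (by
        by_contra! h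
        have := hYt h
        omega)
      rw [h1] at kX
      rw [h2] at kY
      omega
    have hYno : ∀ u ∈ Xᶜ, ∀ v ∈ Xᶜ, ¬ H.Adj u v := by
      by_contra! hcon
      have h3 := hYt hcon
      have h4 := hI X hXno
      rw [h1] at kX
      rw [h2] at kY
      omega
    refine ⟨X, h1, fun u v huv ↦ ⟨fun hu hv ↦ hXno u hu v hv huv, fun hv ↦ ?_⟩⟩
    by_contra hu
    exact hYno u (mem_compl.2 hu) v (mem_compl.2 hv) huv
  · exfalso
    -- For the larger side, `le_of_edge_in_side` with `sX ≤ 2t` simplifies to `n ≤ (t + 2) ^ 2`, so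
    -- `hsq` is just enough. The crossing counts would then differ by `2(n - 1)`, more than the
    -- excess allows.
    have h4 := hI X (by
      intro u hu v hv h
      have := hEX u hu v hv h
      have : (2 + sX) ^ 2 ≤ (2 + 2 * t) ^ 2 := by gcongr; omega
      nlinarith)
    obtain ⟨m, rfl⟩ : ∃ m, n = m + 1 := ⟨n - 1, by omega⟩
    rw [h1] at kX
    rw [show Xᶜ.card = m by omega] at kY
    have : (m + 1 + 1) * (m + 1) = m * (m + 1) + 2 * (m + 1) := by ring
    omega
  · exfalso
    have h4 := hI Xᶜ (by
      intro u hu v hv h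
      have := hEY u hu v hv h
      have : (2 + sY) ^ 2 ≤ (2 + 2 * t) ^ 2 := by gcongr; omega
      nlinarith)
    obtain ⟨m, rfl⟩ : ∃ m, n = m + 1 := ⟨n - 1, by omega⟩
    rw [h2] at kY
    rw [show X.card = m by omega] at kX
    have : (m + 1 + 1) * (m + 1) = m * (m + 1) + 2 * (m + 1) := by ring
    omega

end Bipartition

/-! ### Defects and unjoined points in partial projective planes. -/

/-- A partial projective plane of order `n`: a set of lines with `n + 1` points each, any two of
which meet in exactly one point, on a set of `n ^ 2 + n + 1` points. -/
structure IsPartialProjectivePlane {T : Type*} [Fintype T] [DecidableEq T]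
    (n : ℕ) (B : Finset (Finset T)) : Prop where
  one_le_order : 1 ≤ n
  card_points : Fintype.card T = n ^ 2 + n + 1
  card_line : ∀ l ∈ B, l.card = n + 1
  card_inter : ∀ l ∈ B, ∀ m ∈ B, l ≠ m → (l ∩ m).card = 1

section PartialProjectivePlane

variable {T : Type*} [Fintype T] [DecidableEq T]

/-- The number of lines that a point lacks to lie on `n + 1` of them. -/
def pointDefect (n : ℕ) (B : Finset (Finset T)) (p : T) : ℤ :=
  n + 1 - ((B.filter (p ∈ ·)).card : ℤ)

/-- The points, other than `p`, that no line joins to `p`. -/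
def unjoined (B : Finset (Finset T)) (p : T) : Finset T :=
  univ.filter fun q ↦ q ≠ p ∧ ∀ l ∈ B, p ∈ l → q ∉ l

theorem mem_unjoined {B : Finset (Finset T)} {p q : T} :
    q ∈ unjoined B p ↔ q ≠ p ∧ ∀ l ∈ B, p ∈ l → q ∉ l := by
  simp [unjoined]

theorem mem_unjoined_comm {B : Finset (Finset T)} {p q : T} :
    q ∈ unjoined B p ↔ p ∈ unjoined B q := by
  rw [mem_unjoined, mem_unjoined]
  exact ⟨fun h ↦ ⟨h.1.symm, fun l hl hq hp ↦ h.2 l hl hp hq⟩,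
    fun h ↦ ⟨h.1.symm, fun l hl hq hp ↦ h.2 l hl hp hq⟩⟩

namespace IsPartialProjectivePlane

variable {n : ℕ} {B : Finset (Finset T)}

theorem eq_of_mem (hB : IsPartialProjectivePlane n B) {l m : Finset T} (hl : l ∈ B) (hm : m ∈ B)
    {p q : T} (hpq : p ≠ q) (hpl : p ∈ l) (hpm : p ∈ m) (hql : q ∈ l) (hqm : q ∈ m) : l = m := by
  by_contra h
  have h1 := hB.card_inter l hl m hm h
  exact hpq (card_le_one.1 h1.le p (by simp [*]) q (by simp [*]))

/-- A sum over all points, split along the lines through `p`. -/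
theorem sum_eq (hB : IsPartialProjectivePlane n B) (p : T) (f : T → ℤ) :
    ∑ q, f q = f p + ∑ l ∈ B.filter (p ∈ ·), (∑ q ∈ l, f q - f p) + ∑ q ∈ unjoined B p, f q := by
  have h1 : ∑ l ∈ B.filter (p ∈ ·), (∑ q ∈ l, f q - f p) =
      ∑ q ∈ (univ.erase p) \ unjoined B p, f q := by
    have h2 : ∀ l ∈ B.filter (p ∈ ·), (∑ q ∈ l, f q - f p) = ∑ q ∈ l.erase p, f q := by
      intro l hl
      rw [← add_sum_erase _ _ (mem_filter.1 hl).2]; ring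
    rw [sum_congr rfl h2, ← sum_biUnion]
    · congr 1
      ext q
      simp only [mem_biUnion, mem_filter, mem_erase, mem_sdiff, mem_univ, and_true, mem_unjoined,
        not_and, not_forall, not_not]
      constructor
      · rintro ⟨l, ⟨hl, hp⟩, hq, hql⟩
        exact ⟨hq, fun _ ↦ ⟨l, hl, hp, hql⟩⟩
      · rintro ⟨hq, h⟩
        obtain ⟨l, hl, hp, hql⟩ := h hq
        exact ⟨l, ⟨hl, hp⟩, hq, hql⟩
    · intro l hl m hm hlm
      rw [mem_coe, mem_filter] at hl hm
      rw [Function.onFun, disjoint_left]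
      intro q hql hqm
      rw [mem_erase] at hql hqm
      exact hlm (hB.eq_of_mem hl.1 hm.1 hql.1 hql.2 hqm.2 hl.2 hm.2)
  have h3 : unjoined B p ⊆ univ.erase p := fun q hq ↦ by
    simpa using (mem_unjoined.1 hq).1
  rw [h1, ← add_sum_erase _ _ (mem_univ p), ← sum_sdiff h3]
  ring

/-- Each line through `p` takes exactly one of the `n + 1` points of `l`; the points left over are
unjoined to `p`. -/
theorem card_inter_filter (hB : IsPartialProjectivePlane n B) {l : Finset T} (hl : l ∈ B) (p : T)
    (hp : p ∉ l) : ((l ∩ unjoined B p).card : ℤ) = pointDefect n B p := by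
  have h := hB.sum_eq p fun q ↦ if q ∈ l then 1 else 0
  simp only [hp, if_false, sub_zero, zero_add, sum_ite_mem, univ_inter] at h
  have h1 : ∀ m ∈ B.filter (p ∈ ·), ∑ q ∈ m ∩ l, (1 : ℤ) = 1 := by
    intro m hm
    rw [mem_filter] at hm
    have hml : m ≠ l := by rintro rfl; exact hp hm.2
    simp [hB.card_inter m hm.1 l hl hml]
  rw [sum_congr rfl h1] at h
  simp only [sum_const, nsmul_eq_mul, mul_one, hB.card_line l hl] at h
  rw [inter_comm, pointDefect]
  push_cast at h
  linarith

theorem card_unjoined (hB : IsPartialProjectivePlane n B) (p : T) :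
    ((unjoined B p).card : ℤ) = n * pointDefect n B p := by
  have h := hB.sum_eq p fun _ ↦ 1
  have h1 : ∀ m ∈ B.filter (p ∈ ·), (∑ q ∈ m, (1 : ℤ) - 1) = n := by
    intro m hm
    simp [hB.card_line m (mem_filter.1 hm).1]
  rw [sum_congr rfl h1] at h
  simp only [sum_const, nsmul_eq_mul, mul_one, card_univ, hB.card_points] at h
  rw [pointDefect]
  push_cast at h
  linarith

theorem pointDefect_nonneg (hB : IsPartialProjectivePlane n B) (p : T) :
    0 ≤ pointDefect n B p := by
  have h := hB.card_unjoined p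
  have h1 : (0 : ℤ) < n := by exact_mod_cast hB.one_le_order
  have h2 : (0 : ℤ) ≤ (unjoined B p).card := by positivity
  rw [h] at h2
  exact nonneg_of_mul_nonneg_right h2 h1

theorem pointDefect_pos_of_unjoined (hB : IsPartialProjectivePlane n B) {p q : T}
    (h : q ∈ unjoined B p) : 1 ≤ pointDefect n B q := by
  have h1 := hB.card_unjoined q
  have h2 : (0 : ℤ) < (unjoined B q).card := by
    exact_mod_cast card_pos.2 ⟨p, mem_unjoined_comm.1 h⟩
  rw [h1] at h2
  have h3 := pos_of_mul_pos_right h2 (by positivity)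
  omega

/-- The number of unjoined common points of two joined points. -/
theorem card_unjoined_inter (hB : IsPartialProjectivePlane n B) {p q : T} {l : Finset T}
    (hl : l ∈ B) (hpl : p ∈ l) (hql : q ∈ l) (hpq : p ≠ q) :
    ((unjoined B p ∩ unjoined B q).card : ℤ) = pointDefect n B p * pointDefect n B q := by
  have h := hB.sum_eq q fun x ↦ if x ∈ unjoined B p then 1 else 0
  have hqp : q ∉ unjoined B p := fun h ↦ (mem_unjoined.1 h).2 l hl hpl hql
  simp only [hqp, if_false, sub_zero, zero_add, sum_ite_mem, univ_inter] at h
  have hlq : l ∈ B.filter (q ∈ ·) := mem_filter.2 ⟨hl, hql⟩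
  rw [← add_sum_erase _ _ hlq] at h
  have h0 : l ∩ unjoined B p = ∅ := by
    refine eq_empty_of_forall_notMem fun x hx ↦ ?_
    rw [mem_inter, mem_unjoined] at hx
    exact hx.2.2 l hl hpl hx.1
  -- The lines through `q` other than `l` avoid `p`, so each carries `pointDefect n B p` points
  -- unjoined to `p`, whereas `l` carries none.
  have h1 : ∀ m ∈ (B.filter (q ∈ ·)).erase l,
      ∑ x ∈ m ∩ unjoined B p, (1 : ℤ) = pointDefect n B p := by
    intro m hm
    rw [mem_erase, mem_filter] at hm
    have hpm : p ∉ m := fun hpm ↦ hm.1 (hB.eq_of_mem hm.2.1 hl hpq hpm hpl hm.2.2 hql)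
    rw [← hB.card_inter_filter hm.2.1 p hpm]
    simp
  rw [sum_congr rfl h1, h0, sum_empty] at h
  simp only [sum_const, nsmul_eq_mul, mul_one, hB.card_unjoined p] at h
  have h2 : (((B.filter (q ∈ ·)).erase l).card : ℤ) = n - pointDefect n B q := by
    have := card_erase_add_one hlq
    rw [pointDefect]
    push_cast [← this]
    ring
  rw [h2, inter_comm (unjoined B q)] at h
  linarith

/-- The number of points unjoined to `p` that are joined to a given such point. -/
theorem card_unjoined_sdiff (hB : IsPartialProjectivePlane n B) {p q : T}
    (hq : q ∈ unjoined B p) :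
    (((unjoined B p).erase q \ unjoined B q).card : ℤ) =
      (n + 1 - pointDefect n B q) * (pointDefect n B p - 1) := by
  have h := hB.sum_eq q fun x ↦ if x ∈ unjoined B p then 1 else 0
  simp only [hq, if_true, sum_ite_mem, univ_inter] at h
  have h1 : ∀ m ∈ B.filter (q ∈ ·),
      (∑ x ∈ m ∩ unjoined B p, (1 : ℤ) - 1) = pointDefect n B p - 1 := by
    intro m hm
    rw [mem_filter] at hm
    have hpm : p ∉ m := fun hpm ↦ (mem_unjoined.1 hq).2 m hm.1 hpm hm.2
    rw [← hB.card_inter_filter hm.1 p hpm]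
    simp
  rw [sum_congr rfl h1] at h
  simp only [sum_const, nsmul_eq_mul, mul_one] at h
  have h2 : unjoined B q ∩ unjoined B p ⊆ (unjoined B p).erase q := by
    intro x hx
    rw [mem_inter] at hx
    exact mem_erase.2 ⟨(mem_unjoined.1 hx.1).1, hx.2⟩
  have h3 : (unjoined B p).erase q \ unjoined B q =
      (unjoined B p).erase q \ (unjoined B q ∩ unjoined B p) := by
    ext x; simp only [mem_sdiff, mem_erase, mem_inter]; tauto
  have h4 := card_sdiff_add_card_eq_card h2
  have h5 := card_erase_add_one hq
  rw [h3, show (n + 1 - pointDefect n B q : ℤ) = (B.filter (q ∈ ·)).card by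
    rw [pointDefect]; ring]
  zify at h4 h5
  linarith

/-- The total defect of the points of a line is the number of missing lines. -/
theorem sum_pointDefect_line (hB : IsPartialProjectivePlane n B) {l : Finset T} (hl : l ∈ B) :
    ∑ p ∈ l, pointDefect n B p = n ^ 2 + n + 1 - B.card := by
  have h1 : ∑ p ∈ l, (B.filter (p ∈ ·)).card = ∑ m ∈ B, (l ∩ m).card := by
    have h := sum_card_bipartiteAbove_eq_sum_card_bipartiteBelow (s := l) (t := B)
      (fun p m ↦ p ∈ m)
    convert h using 2 with m _ m _
    · simp [bipartiteAbove]
    · simp [bipartiteBelow, filter_mem_eq_inter]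
  rw [← add_sum_erase _ _ hl, inter_self, hB.card_line l hl] at h1
  have h2 : ∀ m ∈ B.erase l, (l ∩ m).card = 1 := fun m hm ↦ by
    rw [mem_erase] at hm
    exact hB.card_inter l hl m hm.2 hm.1.symm
  rw [sum_congr rfl h2, ← card_eq_sum_ones] at h1
  have h3 := card_erase_add_one hl
  simp only [pointDefect, sum_sub_distrib, sum_const, nsmul_eq_mul, hB.card_line l hl]
  zify at h1 h3
  rw [h1]
  push_cast
  linarith

/-- Weighted double count of incidences; weights `1` and `pointDefect` give the first and second
moments of the defects. -/
theorem sum_mul_eq (n : ℕ) (B : Finset (Finset T)) (f : T → ℤ) :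
    ∑ p, (n + 1 - pointDefect n B p) * f p = ∑ l ∈ B, ∑ p ∈ l, f p := by
  have h1 : ∀ p, (n + 1 - pointDefect n B p) * f p = ∑ l ∈ B, if p ∈ l then f p else 0 := by
    intro p
    rw [← sum_filter, sum_const, nsmul_eq_mul, pointDefect]
    ring
  rw [sum_congr rfl fun p _ ↦ h1 p, sum_comm]
  simp

theorem sum_pointDefect (hB : IsPartialProjectivePlane n B) :
    ∑ p, pointDefect n B p = (n + 1) * (n ^ 2 + n + 1 - B.card) := by
  have h := sum_mul_eq n B fun _ ↦ 1
  have h1 : ∀ l ∈ B, ∑ p ∈ l, (1 : ℤ) = n + 1 := fun l hl ↦ by simp [hB.card_line l hl]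
  rw [sum_congr rfl h1] at h
  simp only [mul_one, sum_sub_distrib, sum_const, nsmul_eq_mul, card_univ, hB.card_points] at h
  push_cast at h
  linarith

theorem sum_pointDefect_sq (hB : IsPartialProjectivePlane n B) :
    ∑ p, pointDefect n B p ^ 2 =
      (n ^ 2 + n + 1 - B.card) * (n + (n ^ 2 + n + 1 - B.card)) := by
  have h := sum_mul_eq n B (pointDefect n B)
  rw [sum_congr rfl fun l hl ↦ hB.sum_pointDefect_line hl] at h
  have h1 : ∀ p, (n + 1 - pointDefect n B p) * pointDefect n B p =
      (n + 1) * pointDefect n B p - pointDefect n B p ^ 2 := fun p ↦ by ring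
  rw [sum_congr rfl fun p _ ↦ h1 p, sum_sub_distrib, ← mul_sum, hB.sum_pointDefect] at h
  simp only [sum_const, nsmul_eq_mul] at h
  linarith

theorem sum_pointDefect_unjoined (hB : IsPartialProjectivePlane n B) (p : T) :
    ∑ q ∈ unjoined B p, pointDefect n B q =
      pointDefect n B p * ((n ^ 2 + n + 1 - B.card) + n - pointDefect n B p) := by
  have h := hB.sum_eq p (pointDefect n B)
  have h1 : ∀ l ∈ B.filter (p ∈ ·), (∑ q ∈ l, pointDefect n B q - pointDefect n B p) =
      (n ^ 2 + n + 1 - B.card) - pointDefect n B p := fun l hl ↦ by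
    rw [hB.sum_pointDefect_line (mem_filter.1 hl).1]
  rw [sum_congr rfl h1, hB.sum_pointDefect] at h
  simp only [sum_const, nsmul_eq_mul] at h
  rw [show ((B.filter (p ∈ ·)).card : ℤ) = n + 1 - pointDefect n B p by
    rw [pointDefect]; ring] at h
  linarith

/-- A set of `n + 1` points that meets every line once is a further line. -/
theorem insert_line (hB : IsPartialProjectivePlane n B) {m : Finset T} (hm : m.card = n + 1)
    (h : ∀ l ∈ B, (l ∩ m).card = 1) : m ∉ B ∧ IsPartialProjectivePlane n (insert m B) := by
  constructor
  · intro hmB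
    have h1 := h m hmB
    rw [inter_self] at h1
    have := hB.one_le_order
    omega
  · refine ⟨hB.one_le_order, hB.card_points, ?_, ?_⟩
    · simp only [mem_insert, forall_eq_or_imp]
      exact ⟨hm, hB.card_line⟩
    · intro l hl l' hl' hne
      rw [mem_insert] at hl hl'
      rcases hl with rfl | hl <;> rcases hl' with rfl | hl'
      · exact absurd rfl hne
      · rw [inter_comm]; exact h _ hl'
      · exact h _ hl
      · exact hB.card_inter l hl l' hl' hne

theorem inter_insert_of_mem {l : Finset T} {p : T} (hl : l ∈ B) (hp : p ∈ l) {X : Finset T}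
    (hX : X ⊆ unjoined B p) : l ∩ insert p X = {p} := by
  ext q
  simp only [mem_inter, mem_insert, mem_singleton]
  constructor
  · rintro ⟨hq, h | h⟩
    · exact h
    · exact absurd hq ((mem_unjoined.1 (hX h)).2 l hl hp)
  · rintro rfl; exact ⟨hp, Or.inl rfl⟩

/-- A point of defect one lies on a missing line. -/
theorem exists_insert_of_defect_one (hB : IsPartialProjectivePlane n B) {p : T}
    (hp : pointDefect n B p = 1) : ∃ m, m ∉ B ∧ IsPartialProjectivePlane n (insert m B) := by
  have hpp : p ∉ unjoined B p := fun h ↦ (mem_unjoined.1 h).1 rfl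
  refine ⟨insert p (unjoined B p), hB.insert_line ?_ fun l hl ↦ ?_⟩
  · rw [card_insert_of_notMem hpp]
    have h := hB.card_unjoined p
    rw [hp] at h
    omega
  · by_cases hpl : p ∈ l
    · rw [inter_insert_of_mem hl hpl subset_rfl, card_singleton]
    · rw [inter_insert_of_notMem hpl]
      have h := hB.card_inter_filter hl p hpl
      rw [hp] at h
      exact_mod_cast h

/-- If no point has defect one, many points have defect two. -/
theorem le_card_defect_two (hB : IsPartialProjectivePlane n B) (h1 : ∀ p, pointDefect n B p ≠ 1) :
    (n ^ 2 + n + 1 - B.card : ℤ) * (2 * n + 3 - (n ^ 2 + n + 1 - B.card)) ≤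
      2 * (univ.filter (pointDefect n B · = 2)).card := by
  -- Pointwise this is `d * (d - 3) ≥ 0`, which among the admissible defects fails only at `d = 2`;
  -- the indicator makes up for the loss of 2 there.
  have h : ∑ p, pointDefect n B p ≤ ∑ p, (pointDefect n B p ^ 2 - 2 * pointDefect n B p +
      2 * if pointDefect n B p = 2 then 1 else 0) := by
    refine sum_le_sum fun p _ ↦ ?_
    have h2 := hB.pointDefect_nonneg p
    have h3 := h1 p
    split_ifs with h4
    · rw [h4]; norm_num
    · have h5 : pointDefect n B p = 0 ∨ 3 ≤ pointDefect n B p := by omega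
      rcases h5 with h5 | h5
      · simp [h5]
      · nlinarith
  rw [sum_add_distrib, sum_sub_distrib, ← mul_sum, ← mul_sum, hB.sum_pointDefect_sq,
    hB.sum_pointDefect, sum_boole] at h
  linarith

end IsPartialProjectivePlane

end PartialProjectivePlane

/-! ### Adding missing lines to a partial projective plane. -/

section PartialProjectivePlane

variable {T : Type*} [Fintype T] [DecidableEq T]

namespace IsPartialProjectivePlane

variable {n : ℕ} {B : Finset (Finset T)}

/-- Two points are adjacent in this graph if they are distinct and on a common line. -/
def joinGraph (B : Finset (Finset T)) (p : T) : SimpleGraph {q // q ∈ unjoined B p} where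
  Adj x y := x.1 ≠ y.1 ∧ y.1 ∉ unjoined B x.1
  symm := ⟨fun _ _ h ↦ ⟨h.1.symm, fun h' ↦ h.2 (mem_unjoined_comm.1 h')⟩⟩
  loopless := ⟨fun _ h ↦ h.1 rfl⟩

instance (B : Finset (Finset T)) (p : T) : DecidableRel (joinGraph B p).Adj :=
  fun x y ↦ inferInstanceAs (Decidable (x.1 ≠ y.1 ∧ y.1 ∉ unjoined B x.1))

theorem map_neighborFinset_joinGraph (B : Finset (Finset T)) (p : T)
    (x : {q // q ∈ unjoined B p}) :
    ((joinGraph B p).neighborFinset x).map (Function.Embedding.subtype _) =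
      (unjoined B p).erase x.1 \ unjoined B x.1 := by
  ext q
  simp only [mem_map, SimpleGraph.mem_neighborFinset, Function.Embedding.subtype_apply,
    mem_sdiff, mem_erase]
  constructor
  · rintro ⟨y, ⟨h1, h2⟩, rfl⟩
    exact ⟨⟨h1.symm, y.2⟩, h2⟩
  · rintro ⟨⟨h1, h2⟩, h3⟩
    exact ⟨⟨q, h2⟩, ⟨h1.symm, h3⟩, rfl⟩

theorem exists_line_of_not_unjoined {x y : T} (hxy : x ≠ y) (h : y ∉ unjoined B x) :
    ∃ l ∈ B, x ∈ l ∧ y ∈ l := by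
  by_contra! hcon
  exact h (mem_unjoined.2 ⟨hxy.symm, hcon⟩)

theorem card_neighborFinset_joinGraph (hB : IsPartialProjectivePlane n B) {p : T}
    (hp : pointDefect n B p = 2) (x : {q // q ∈ unjoined B p}) :
    (((joinGraph B p).neighborFinset x).card : ℤ) = n + 1 - pointDefect n B x.1 := by
  rw [← card_map, map_neighborFinset_joinGraph, hB.card_unjoined_sdiff x.2, hp]
  ring

/-- Vertices adjacent to neither `x` nor `y` are unjoined to both, as is `p`, which is not a vertex.
By `card_unjoined_inter` there are thus at most `d x * d y - 1` of them, and inclusion-exclusion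
among the `2 * n` vertices turns this into the bound. -/
theorem card_inter_neighborFinset_joinGraph_le (hB : IsPartialProjectivePlane n B) {p : T}
    (hp : pointDefect n B p = 2) {x y : {q // q ∈ unjoined B p}} (hxy : (joinGraph B p).Adj x y) :
    ((((joinGraph B p).neighborFinset x) ∩ (joinGraph B p).neighborFinset y).card : ℤ) ≤
      (pointDefect n B x.1 - 1) * (pointDefect n B y.1 - 1) := by
  obtain ⟨l, hl, hxl, hyl⟩ := exists_line_of_not_unjoined hxy.1 hxy.2
  have h1 := hB.card_unjoined_inter hl hxl hyl hxy.1
  have h2 := hB.card_neighborFinset_joinGraph hp x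
  have h3 := hB.card_neighborFinset_joinGraph hp y
  have h4 := hB.card_unjoined p
  rw [hp] at h4
  set H := joinGraph B p
  have h5 := card_union_add_card_inter (H.neighborFinset x) (H.neighborFinset y)
  have h6 : (((H.neighborFinset x ∪ H.neighborFinset y)ᶜ).map
      (Function.Embedding.subtype _)) ⊆ (unjoined B x.1 ∩ unjoined B y.1).erase p := by
    intro q hq
    simp only [mem_map, Function.Embedding.subtype_apply, mem_compl, mem_union,
      SimpleGraph.mem_neighborFinset, not_or] at hq
    obtain ⟨z, ⟨hz1, hz2⟩, rfl⟩ := hq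
    have hzx : z ≠ x := by rintro rfl; exact hz2 hxy.symm
    have hzy : z ≠ y := by rintro rfl; exact hz1 hxy
    rw [mem_erase, mem_inter]
    refine ⟨(mem_unjoined.1 z.2).1, ?_, ?_⟩
    · by_contra h
      exact hz1 ⟨fun h ↦ hzx (Subtype.ext h.symm), h⟩
    · by_contra h
      exact hz2 ⟨fun h ↦ hzy (Subtype.ext h.symm), h⟩
  have h7 : p ∈ unjoined B x.1 ∩ unjoined B y.1 :=
    mem_inter.2 ⟨mem_unjoined_comm.1 x.2, mem_unjoined_comm.1 y.2⟩
  have h8 := card_le_card h6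
  have h9 := card_erase_add_one h7
  have h10 := card_add_card_compl (H.neighborFinset x ∪ H.neighborFinset y)
  rw [card_map] at h8
  rw [Fintype.card_coe] at h10
  zify at h5 h8 h9 h10
  linarith

/-- A point of defect two lies on a missing line, if the defects of the points unjoined to it are
small. -/
theorem exists_insert_of_defect_two (hB : IsPartialProjectivePlane n B) {t : ℕ}
    (hN : (n ^ 2 + n + 1 - B.card : ℤ) = n + 2 + t) (h1 : ∀ p, pointDefect n B p ≠ 1)
    (hnt : 6 * t + 6 ≤ n) (hsq : (t + 2) ^ 2 < n) {p : T} (hp : pointDefect n B p = 2)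
    (hq : ∀ q ∈ unjoined B p, 3 * (pointDefect n B q - 2) + 6 < n) :
    ∃ m, m ∉ B ∧ IsPartialProjectivePlane n (insert m B) := by
  have h2 : ∀ q ∈ unjoined B p, 2 ≤ pointDefect n B q := fun q hq ↦ by
    have := hB.pointDefect_pos_of_unjoined hq
    have := h1 q
    omega
  let e : {q // q ∈ unjoined B p} → ℕ := fun q ↦ (pointDefect n B q.1 - 2).toNat
  have hee : ∀ q, (e q : ℤ) = pointDefect n B q.1 - 2 := fun q ↦
    Int.toNat_of_nonneg (by have := h2 q.1 q.2; omega)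
  have hcard := hB.card_unjoined p
  rw [hp] at hcard
  obtain ⟨X, hXc, hX⟩ := exists_bipartition (H := joinGraph B p) (n := n) (t := t) (e := e)
    (by rw [Fintype.card_coe]; omega)
    (fun v ↦ by
      have := hB.card_neighborFinset_joinGraph hp v
      have := hee v
      omega)
    (by
      zify
      rw [sum_congr rfl fun q _ ↦ hee q, sum_coe_sort (unjoined B p) fun q ↦ pointDefect n B q - 2,
        sum_sub_distrib, hB.sum_pointDefect_unjoined, hN, hp]
      simp only [sum_const, nsmul_eq_mul, hcard]
      ring)
    (fun u v huv ↦ by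
      have := hB.card_inter_neighborFinset_joinGraph_le hp huv
      zify
      rw [hee, hee]
      convert this using 1
      ring)
    (fun v ↦ by
      have := hq v.1 v.2
      have := hee v
      omega) hnt hsq
  set Y := X.map (Function.Embedding.subtype _) with hY
  have hYs : Y ⊆ unjoined B p := by
    intro q hq
    rw [hY, mem_map] at hq
    obtain ⟨x, -, rfl⟩ := hq
    exact x.2
  have memY : ∀ x : {q // q ∈ unjoined B p}, x.1 ∈ Y ↔ x ∈ X := fun x ↦ by
    simp [hY]
  refine ⟨insert p Y, hB.insert_line ?_ fun l hl ↦ ?_⟩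
  · rw [card_insert_of_notMem fun h ↦ (mem_unjoined.1 (hYs h)).1 rfl, hY, card_map, hXc]
  · by_cases hpl : p ∈ l
    · rw [inter_insert_of_mem hl hpl hYs, card_singleton]
    · rw [inter_insert_of_notMem hpl]
      have h := hB.card_inter_filter hl p hpl
      rw [hp] at h
      -- The two points of `l` unjoined to `p` are adjacent because `l` joins them, so exactly one
      -- lies in `Y`.
      obtain ⟨x, y, hxy, hxy'⟩ := card_eq_two.1 (show (l ∩ unjoined B p).card = 2 by
        exact_mod_cast h)
      have hx : x ∈ l ∩ unjoined B p := by rw [hxy']; simp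
      have hy : y ∈ l ∩ unjoined B p := by rw [hxy']; simp
      rw [mem_inter] at hx hy
      have hadj : (joinGraph B p).Adj ⟨x, hx.2⟩ ⟨y, hy.2⟩ :=
        ⟨hxy, fun h ↦ (mem_unjoined.1 h).2 l hl hx.1 hy.1⟩
      have hor := hX _ _ hadj
      rw [← memY, ← memY] at hor
      have h3 : l ∩ Y = ({x, y} : Finset T) ∩ Y := by
        rw [← hxy', inter_assoc, inter_eq_right.2 hYs]
      rw [h3]
      by_cases hxY : x ∈ Y
      · rw [insert_inter_of_mem hxY, singleton_inter_of_notMem (hor.1 hxY), insert_empty_eq,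
          card_singleton]
      · have hyY : y ∈ Y := by
          by_contra h
          exact hxY (hor.2 h)
        rw [insert_inter_of_notMem hxY, singleton_inter_of_mem hyY, card_singleton]

/-- The number of missing lines is small enough for a completion to exist. -/
def FewMissing (n : ℕ) (N : ℕ) : Prop :=
  ∀ t, N = n + 2 + t → (t + 2) ^ 2 < n ∧ 6 * t + 6 ≤ n ∧ (6 * t + 6 = n → t = 2)

/-- Lowering `t` makes `6 * t + 6 < n` strict, so the borderline case can occur only before the
first line is added. -/
theorem FewMissing.of_succ {n N : ℕ} (h : FewMissing n (N + 1)) : FewMissing n N := by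
  intro t ht
  obtain ⟨h1, h2, -⟩ := h (t + 1) (by omega)
  exact ⟨by nlinarith, by omega, by omega⟩

theorem pointDefect_sub_two_le (hB : IsPartialProjectivePlane n B) {t : ℕ}
    (hN : (n ^ 2 + n + 1 - B.card : ℤ) = n + 2 + t) (h1 : ∀ p, pointDefect n B p ≠ 1)
    {p q : T} (hp : pointDefect n B p = 2) (hq : q ∈ unjoined B p) :
    pointDefect n B q - 2 ≤ 2 * t := by
  have h2 : ∀ q ∈ unjoined B p, 0 ≤ pointDefect n B q - 2 := fun q hq ↦ by
    have := hB.pointDefect_pos_of_unjoined hq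
    have := h1 q
    omega
  have h3 := single_le_sum h2 hq
  rw [sum_sub_distrib, hB.sum_pointDefect_unjoined, hN, hp] at h3
  simp only [sum_const, nsmul_eq_mul, hB.card_unjoined, hp] at h3
  linarith

/-- Excesses near a point of defect two are at most `2 * t`, so the required bound is automatic
unless `n = 6 * t + 6`, that is, `t = 2` and `n = 18`. There a bad point has defect 6, and a point
of defect two joined to it is used instead. -/
theorem exists_defect_two (hB : IsPartialProjectivePlane n B) {t : ℕ}
    (hN : (n ^ 2 + n + 1 - B.card : ℤ) = n + 2 + t) (h1 : ∀ p, pointDefect n B p ≠ 1)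
    (hnt : 6 * t + 6 ≤ n) (hexc : 6 * t + 6 = n → t = 2) :
    ∃ p, pointDefect n B p = 2 ∧ ∀ q ∈ unjoined B p, 3 * (pointDefect n B q - 2) + 6 < n := by
  have hmany := hB.le_card_defect_two h1
  rw [hN] at hmany
  have hnt' : (6 * t + 6 : ℤ) ≤ n := by exact_mod_cast hnt
  have hpos : (0 : ℤ) < (univ.filter (pointDefect n B · = 2)).card := by nlinarith
  obtain ⟨p, hp⟩ := card_pos.1 (by exact_mod_cast hpos)
  replace hp := (mem_filter.1 hp).2
  by_cases hall : ∀ q ∈ unjoined B p, 3 * (pointDefect n B q - 2) + 6 < n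
  · exact ⟨p, hp, hall⟩
  · push Not at hall
    obtain ⟨q₀, hq₀, hq₀'⟩ := hall
    have h2 := hB.pointDefect_sub_two_le hN h1 hp hq₀
    obtain rfl : t = 2 := hexc (by omega)
    obtain rfl : n = 18 := by omega
    have hd₀ : pointDefect 18 B q₀ = 6 := by push_cast at *; omega
    -- With `N = 22` at least `22 * 17 / 2 = 187` points have defect two, but only `18 * 6 = 108`
    -- points are unjoined to `q₀`.
    obtain ⟨p', hp', hq'⟩ : ∃ p' ∈ univ.filter (pointDefect 18 B · = 2), p' ∉ unjoined B q₀ := by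
      refine exists_mem_notMem_of_card_lt_card ?_
      have h3 := hB.card_unjoined q₀
      rw [hd₀] at h3
      push_cast at *
      omega
    replace hp' := (mem_filter.1 hp').2
    refine ⟨p', hp', fun q hq ↦ ?_⟩
    have h4 := hB.pointDefect_sub_two_le hN h1 hp' hq
    by_contra h5
    have hd : pointDefect 18 B q = 6 := by push_cast at *; omega
    have hqq : q ≠ q₀ := by rintro rfl; exact hq' (mem_unjoined_comm.1 hq)
    -- Two points of defect 6 contribute 48 to `∑ d * (d - 2)`, whose value is `22 * 2 = 44`.
    have h6 : ∑ x ∈ ({q, q₀} : Finset T), (pointDefect 18 B x ^ 2 - 2 * pointDefect 18 B x) ≤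
        ∑ x, (pointDefect 18 B x ^ 2 - 2 * pointDefect 18 B x) := by
      refine sum_le_sum_of_subset_of_nonneg (subset_univ _) fun x _ _ ↦ ?_
      have h7 := hB.pointDefect_nonneg x
      have h8 := h1 x
      have h9 : pointDefect 18 B x = 0 ∨ 2 ≤ pointDefect 18 B x := by omega
      rcases h9 with h9 | h9
      · simp [h9]
      · nlinarith
    rw [sum_pair hqq, hd, hd₀, sum_sub_distrib, ← mul_sum, hB.sum_pointDefect_sq,
      hB.sum_pointDefect, hN] at h6
    norm_num at h6

/-- A missing line can be added. -/
theorem exists_insert (hB : IsPartialProjectivePlane n B) {N : ℕ}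
    (hN : B.card + N = n ^ 2 + n + 1) (h0 : 0 < N) (hfew : FewMissing n N) :
    ∃ m, m ∉ B ∧ IsPartialProjectivePlane n (insert m B) := by
  by_cases h1 : ∃ p, pointDefect n B p = 1
  · obtain ⟨p, hp⟩ := h1
    exact hB.exists_insert_of_defect_one hp
  push Not at h1
  have hN' : (n ^ 2 + n + 1 - B.card : ℤ) = N := by zify at hN; linarith
  by_cases ht : n + 2 ≤ N
  · obtain ⟨t, rfl⟩ := Nat.exists_eq_add_of_le ht
    obtain ⟨h2, h3, h4⟩ := hfew t rfl
    push_cast at hN'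
    obtain ⟨p, hp, hq⟩ := hB.exists_defect_two hN' h1 h3 h4
    exact hB.exists_insert_of_defect_two hN' h1 h3 h2 hp hq
  · exfalso
    -- The sum equals `N * (N - n - 2)`, which is negative for `0 < N ≤ n + 1`.
    have h : 0 ≤ ∑ p, (pointDefect n B p ^ 2 - 2 * pointDefect n B p) := by
      refine sum_nonneg fun p _ ↦ ?_
      have h7 := hB.pointDefect_nonneg p
      have h8 := h1 p
      have h9 : pointDefect n B p = 0 ∨ 2 ≤ pointDefect n B p := by omega
      rcases h9 with h9 | h9
      · simp [h9]
      · nlinarith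
    rw [sum_sub_distrib, ← mul_sum, hB.sum_pointDefect_sq, hB.sum_pointDefect, hN'] at h
    have h2 : (N : ℤ) ≤ n + 1 := by omega
    have h3 : (0 : ℤ) < N := by exact_mod_cast h0
    nlinarith

/-- A partial projective plane with few missing lines is part of one with no missing lines. -/
theorem exists_completion {N : ℕ} : ∀ {B : Finset (Finset T)}, IsPartialProjectivePlane n B →
    B.card + N = n ^ 2 + n + 1 → FewMissing n N →
    ∃ B', B ⊆ B' ∧ IsPartialProjectivePlane n B' ∧ B'.card = n ^ 2 + n + 1 := by
  induction N with
  | zero => exact fun hB hN _ ↦ ⟨_, subset_rfl, hB, hN⟩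
  | succ N ih =>
    intro B hB hN hfew
    obtain ⟨m, hm, hmB⟩ := hB.exists_insert hN (Nat.succ_pos N) hfew
    obtain ⟨B', h1, h2⟩ := ih hmB (by rw [card_insert_of_notMem hm]; omega) hfew.of_succ
    exact ⟨B', (subset_insert _ _).trans h1, h2⟩

/-- If no line is missing, then any two points are joined. -/
theorem exists_line (hB : IsPartialProjectivePlane n B) (hN : B.card = n ^ 2 + n + 1) {p q : T}
    (hpq : p ≠ q) : ∃ l ∈ B, p ∈ l ∧ q ∈ l := by
  have h0 : pointDefect n B p = 0 := by
    have h := hB.sum_pointDefect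
    rw [hN] at h
    push_cast at h
    rw [sub_self, mul_zero, sum_eq_zero_iff_of_nonneg fun p _ ↦ hB.pointDefect_nonneg p] at h
    exact h p (mem_univ p)
  refine exists_line_of_not_unjoined hpq fun h ↦ ?_
  have h1 := hB.card_unjoined p
  rw [h0, mul_zero] at h1
  have h2 : unjoined B p = ∅ := card_eq_zero.1 (by exact_mod_cast h1)
  rw [h2] at h
  simp at h

end IsPartialProjectivePlane

end PartialProjectivePlane

/-! ### Counting parallel classes. -/

theorem ParallelismIsEquivalence.symm {P : Type*} {A : Finset (Finset P)}
    (h : ParallelismIsEquivalence A) {l m : Finset P}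
    (hl : l ∈ A) (hm : m ∈ A) (hlm : LinesParallel l m) : LinesParallel m l :=
  Equivalence.symm h (x := ⟨l, hl⟩) (y := ⟨m, hm⟩) hlm

theorem ParallelismIsEquivalence.trans {P : Type*} {A : Finset (Finset P)}
    (h : ParallelismIsEquivalence A) {l m k : Finset P}
    (hl : l ∈ A) (hm : m ∈ A) (hk : k ∈ A) (hlm : LinesParallel l m) (hmk : LinesParallel m k) :
    LinesParallel l k :=
  Equivalence.trans h (x := ⟨l, hl⟩) (y := ⟨m, hm⟩) (z := ⟨k, hk⟩) hlm hmk

section ParallelClasses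

variable {P : Type*} [DecidableEq P] {n : ℕ} {A : Finset (Finset P)}

instance (l m : Finset P) : Decidable (LinesParallel l m) :=
  inferInstanceAs (Decidable (l = m ∨ Disjoint l m))

/-- The lines parallel to `l`. -/
def parallelClass (A : Finset (Finset P)) (l : Finset P) : Finset (Finset P) :=
  A.filter (LinesParallel l)

/-- The parallel classes of the lines. -/
def parallelClasses (A : Finset (Finset P)) : Finset (Finset (Finset P)) :=
  A.image (parallelClass A)

/-- The lines through a point. -/
def linesThrough (A : Finset (Finset P)) (p : P) : Finset (Finset P) :=
  A.filter (p ∈ ·)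

theorem mem_parallelClass {l m : Finset P} :
    m ∈ parallelClass A l ↔ m ∈ A ∧ LinesParallel l m :=
  mem_filter

theorem mem_parallelClass_self {l : Finset P} (hl : l ∈ A) : l ∈ parallelClass A l :=
  mem_filter.2 ⟨hl, Or.inl rfl⟩

theorem parallelClass_eq_iff (h : ParallelismIsEquivalence A) {l m : Finset P} (hl : l ∈ A)
    (hm : m ∈ A) : parallelClass A l = parallelClass A m ↔ LinesParallel l m := by
  constructor
  · intro hlm
    have h1 := mem_parallelClass_self hm
    rw [← hlm] at h1
    exact (mem_filter.1 h1).2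
  · intro hlm
    ext k
    simp only [parallelClass, mem_filter]
    exact and_congr_right fun hk ↦ ⟨fun h1 ↦ h.trans hm hl hk (h.symm hl hm hlm) h1,
      fun h1 ↦ h.trans hl hm hk hlm h1⟩

theorem filter_parallelClass_eq (h : ParallelismIsEquivalence A) {l : Finset P} (hl : l ∈ A) :
    A.filter (parallelClass A · = parallelClass A l) = parallelClass A l := by
  ext m
  rw [mem_filter, mem_parallelClass]
  refine and_congr_right fun hm ↦ ?_
  rw [eq_comm]
  exact parallelClass_eq_iff h hl hm

/-- A sum over the lines, split along the parallel classes. -/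
theorem sum_parallelClass (h : ParallelismIsEquivalence A)
    (f : Finset (Finset P) → ℤ) :
    ∑ l ∈ A, f (parallelClass A l) = ∑ C ∈ parallelClasses A, (C.card : ℤ) * f C := by
  rw [← sum_fiberwise_of_maps_to (t := parallelClasses A) (g := parallelClass A)
    fun l hl ↦ mem_image_of_mem _ hl]
  refine sum_congr rfl fun C hC ↦ ?_
  obtain ⟨l, hl, rfl⟩ := mem_image.1 hC
  rw [sum_congr rfl fun m hm ↦ by rw [(mem_filter.1 hm).2], sum_const, filter_parallelClass_eq h hl,
    nsmul_eq_mul]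

variable [Fintype P]

theorem sum_linesThrough (A : Finset (Finset P)) (f : P → ℤ) :
    ∑ p, ((linesThrough A p).card : ℤ) * f p = ∑ l ∈ A, ∑ p ∈ l, f p := by
  have h1 : ∀ p, ((linesThrough A p).card : ℤ) * f p = ∑ l ∈ A, if p ∈ l then f p else 0 := by
    intro p
    rw [← sum_filter, sum_const, nsmul_eq_mul, linesThrough]
  rw [sum_congr rfl fun p _ ↦ h1 p, sum_comm]
  simp

namespace IsPartialAffinePlane

theorem eq_of_mem (hA : IsPartialAffinePlane n A) {l m : Finset P} (hl : l ∈ A) (hm : m ∈ A)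
    {p q : P} (hpq : p ≠ q) (hpl : p ∈ l) (hpm : p ∈ m) (hql : q ∈ l) (hqm : q ∈ m) : l = m := by
  by_contra h
  have h1 := hA.card_inter_le_one l hl m hm h
  exact hpq (card_le_one.1 h1 p (by simp [*]) q (by simp [*]))

theorem card_inter_eq_one (hA : IsPartialAffinePlane n A) {l m : Finset P} (hl : l ∈ A)
    (hm : m ∈ A) (h : ¬ LinesParallel l m) : (l ∩ m).card = 1 := by
  rw [LinesParallel, not_or, not_disjoint_iff_nonempty_inter] at h
  exact le_antisymm (hA.card_inter_le_one l hl m hm h.1) (card_pos.2 h.2)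

theorem sum_card_linesThrough (hA : IsPartialAffinePlane n A) :
    ∑ p, ((linesThrough A p).card : ℤ) = n * A.card := by
  have h := sum_linesThrough A fun _ ↦ 1
  have h1 : ∀ l ∈ A, ∑ p ∈ l, (1 : ℤ) = n := fun l hl ↦ by simp [hA.card_line l hl]
  rw [sum_congr rfl h1] at h
  simp only [mul_one, sum_const, nsmul_eq_mul] at h
  rw [h, mul_comm]

theorem sum_card_linesThrough_line (hA : IsPartialAffinePlane n A) {l : Finset P} (hl : l ∈ A) :
    ∑ p ∈ l, ((linesThrough A p).card : ℤ) = A.card - (parallelClass A l).card + n := by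
  have h1 : ∑ p ∈ l, (linesThrough A p).card = ∑ m ∈ A, (l ∩ m).card := by
    have h := sum_card_bipartiteAbove_eq_sum_card_bipartiteBelow (s := l) (t := A)
      (fun p m ↦ p ∈ m)
    convert h using 2 with m _ m _
    · simp [bipartiteAbove, linesThrough]
    · simp [bipartiteBelow, filter_mem_eq_inter]
  have hsub : parallelClass A l ⊆ A := filter_subset _ _
  rw [← sum_sdiff hsub, ← add_sum_erase _ _ (mem_parallelClass_self hl), inter_self,
    hA.card_line l hl] at h1
  have h2 : ∀ m ∈ A \ parallelClass A l, (l ∩ m).card = 1 := fun m hm ↦ by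
    rw [mem_sdiff, mem_parallelClass] at hm
    exact hA.card_inter_eq_one hl hm.1 fun h ↦ hm.2 ⟨hm.1, h⟩
  have h3 : ∀ m ∈ (parallelClass A l).erase l, (l ∩ m).card = 0 := fun m hm ↦ by
    rw [mem_erase, mem_parallelClass] at hm
    rw [card_eq_zero, ← disjoint_iff_inter_eq_empty]
    exact hm.2.2.resolve_left hm.1.symm
  rw [sum_congr rfl h2, ← card_eq_sum_ones, sum_eq_zero h3] at h1
  have h4 := card_sdiff_add_card_eq_card hsub
  zify at h1 h4
  linarith

theorem card_parallelClass_le (hA : IsPartialAffinePlane n A) (h : ParallelismIsEquivalence A)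
    {C : Finset (Finset P)} (hC : C ∈ parallelClasses A) : C.card ≤ n := by
  obtain ⟨l, hl, rfl⟩ := mem_image.1 hC
  have h1 : ((parallelClass A l).biUnion id).card = ∑ m ∈ parallelClass A l, m.card := by
    refine card_biUnion fun m hm k hk hmk ↦ ?_
    rw [mem_coe, mem_parallelClass] at hm hk
    exact (h.trans hm.1 hl hk.1 (h.symm hl hm.1 hm.2) hk.2).resolve_left hmk
  rw [sum_congr rfl fun m hm ↦ hA.card_line m (mem_parallelClass.1 hm).1, sum_const, smul_eq_mul] at h1
  have h2 := card_le_univ ((parallelClass A l).biUnion id)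
  rw [h1, hA.card_points, pow_two] at h2
  exact Nat.le_of_mul_le_mul_right h2 (by have := hA.two_le_order; omega)

/-- Lines through a point off `l` and not parallel to `l` meet `l` in different points. -/
theorem card_linesThrough_le (hA : IsPartialAffinePlane n A) {l : Finset P} (hl : l ∈ A) {p : P}
    (hp : p ∉ l) : ((linesThrough A p).filter (¬ LinesParallel l ·)).card ≤ n := by
  have hex : ∀ m : Finset P, ∃ q, m ∈ (linesThrough A p).filter (¬ LinesParallel l ·) →
      q ∈ l ∧ q ∈ m := by
    intro m
    by_cases hm : m ∈ (linesThrough A p).filter (¬ LinesParallel l ·)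
    · rw [mem_filter, LinesParallel, not_or, not_disjoint_iff] at hm
      exact hm.2.2.imp fun q hq _ ↦ hq
    -- Here `p` is only a default value.
    · exact ⟨p, fun h ↦ absurd h hm⟩
  choose f hf using hex
  rw [← hA.card_line l hl]
  refine card_le_card_of_injOn f (fun m hm ↦ (hf m hm).1) fun m hm k hk hmk ↦ ?_
  obtain ⟨h1, h2⟩ := hf m hm
  have h3 := (hf k hk).2
  rw [← hmk] at h3
  simp only [mem_coe, linesThrough, mem_filter] at hm hk
  exact hA.eq_of_mem hm.1.1 hk.1.1 (fun h ↦ hp (by rw [h]; exact h1)) hm.1.2 hk.1.2 h2 h3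

/-- If there are more than `n + 1` parallel classes, no point is on more than `n` lines. -/
theorem card_linesThrough_le_of_classes (hA : IsPartialAffinePlane n A)
    (h : ParallelismIsEquivalence A) (hk : n + 2 ≤ (parallelClasses A).card) (p : P) :
    (linesThrough A p).card ≤ n := by
  have hinj : Set.InjOn (parallelClass A) (linesThrough A p) := by
    intro l hl m hm hlm
    simp only [mem_coe, linesThrough, mem_filter] at hl hm
    rw [parallelClass_eq_iff h hl.1 hm.1] at hlm
    exact hlm.resolve_right (not_disjoint_iff.2 ⟨p, hl.2, hm.2⟩)
  have hsub : (linesThrough A p).image (parallelClass A) ⊆ parallelClasses A :=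
    image_subset_image (filter_subset _ _)
  by_cases hall : (linesThrough A p).image (parallelClass A) = parallelClasses A
  · exfalso
    rw [← hall, card_image_of_injOn hinj] at hk
    -- If all lines passed through `p`, they would be disjoint away from it, so there would be at
    -- most `n + 1` of them. A line `l` off `p` allows at most `n` lines through `p` that meet it
    -- and one parallel to it.
    obtain ⟨l, hl, hpl⟩ : ∃ l ∈ A, p ∉ l := by
      by_contra! hcon
      have h1 : linesThrough A p = A := filter_true_of_mem hcon
      rw [h1] at hk
      have h2 : (A.biUnion (·.erase p)).card = ∑ l ∈ A, (l.erase p).card := by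
        refine card_biUnion fun l hl m hm hlm ↦ disjoint_left.2 fun q hq hq' ↦ ?_
        rw [mem_erase] at hq hq'
        exact hlm (hA.eq_of_mem hl hm hq.1 hq.2 hq'.2 (hcon l hl) (hcon m hm))
      have h3 : ∀ l ∈ A, (l.erase p).card = n - 1 := fun l hl ↦ by
        rw [card_erase_of_mem (hcon l hl), hA.card_line l hl]
      rw [sum_congr rfl h3, sum_const, smul_eq_mul] at h2
      have h4 : (A.biUnion (·.erase p)).card ≤ (univ.erase p).card :=
        card_le_card (biUnion_subset.2 fun l _ ↦ erase_subset_erase p (subset_univ l))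
      rw [h2, card_erase_of_mem (mem_univ p), card_univ, hA.card_points] at h4
      obtain ⟨m, rfl⟩ : ∃ m, n = m + 2 := ⟨n - 2, by have := hA.two_le_order; omega⟩
      rw [show m + 2 - 1 = m + 1 by omega, show (m + 2) ^ 2 - 1 = m ^ 2 + 4 * m + 3 by
        rw [show (m + 2) ^ 2 = m ^ 2 + 4 * m + 3 + 1 by ring, Nat.add_sub_cancel]] at h4
      nlinarith
    have h1 := hA.card_linesThrough_le hl hpl
    have h2 : ((linesThrough A p).filter (LinesParallel l ·)).card ≤ 1 := by
      rw [card_le_one]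
      intro m hm k hk
      rw [mem_filter] at hm hk
      refine hinj hm.1 hk.1 ?_
      have hm' := (mem_filter.1 hm.1).1
      have hk' := (mem_filter.1 hk.1).1
      rw [parallelClass_eq_iff h hm' hk']
      exact h.trans hm' hl hk' (h.symm hl hm' hm.2) hk.2
    have h3 := card_filter_add_card_filter_not (s := linesThrough A p) (LinesParallel l ·)
    omega
  · obtain ⟨C, hC, hC'⟩ := exists_of_ssubset (hsub.ssubset_of_ne hall)
    obtain ⟨l, hl, rfl⟩ := mem_image.1 hC
    have hne : ∀ m ∈ linesThrough A p, ¬ LinesParallel l m := by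
      intro m hm hlm
      have hm' := (mem_filter.1 hm).1
      rw [← parallelClass_eq_iff h hl hm'] at hlm
      exact hC' (mem_image.2 ⟨m, hm, hlm.symm⟩)
    have hpl : p ∉ l := fun hp ↦ hne l (mem_filter.2 ⟨hl, hp⟩) (Or.inl rfl)
    have h1 := hA.card_linesThrough_le hl hpl
    rwa [filter_true_of_mem hne] at h1

/-- There are at most `n + 1` parallel classes. -/
theorem card_parallelClasses_le (hA : IsPartialAffinePlane n A) (h : ParallelismIsEquivalence A)
    {a : ℕ} (h1a : 1 ≤ a) (hb : A.card + a = n ^ 2) (ha : a ^ 2 < n) : (parallelClasses A).card ≤ n + 1 := by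
  by_contra! hk
  have hr := hA.card_linesThrough_le_of_classes h hk
  set K := parallelClasses A with hK
  let D : P → ℤ := fun p ↦ n - (linesThrough A p).card
  let u : Finset (Finset P) → ℤ := fun C ↦ n - C.card
  have hD0 : ∀ p, 0 ≤ D p := fun p ↦ by
    have : ((linesThrough A p).card : ℤ) ≤ n := by exact_mod_cast hr p
    simp only [D]; linarith
  have hu0 : ∀ C ∈ K, 0 ≤ u C := fun C hC ↦ by
    have : (C.card : ℤ) ≤ n := by exact_mod_cast hA.card_parallelClass_le h hC
    simp only [u]; linarith
  have hb' : (A.card : ℤ) = n ^ 2 - a := by zify at hb; linarith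
  have hn2 : (2 : ℤ) ≤ n := by exact_mod_cast hA.two_le_order
  have ha' : (a : ℤ) ^ 2 < n := by exact_mod_cast ha
  have hline : ∀ l ∈ A, ∑ p ∈ l, D p = a - u (parallelClass A l) := fun l hl ↦ by
    simp only [D, u]
    rw [sum_sub_distrib, hA.sum_card_linesThrough_line hl, sum_const, hA.card_line l hl, hb',
      nsmul_eq_mul]
    ring
  have hua : ∀ C ∈ K, u C ≤ a := fun C hC ↦ by
    obtain ⟨l, hl, rfl⟩ := mem_image.1 hC
    have h1 := hline l hl
    have h2 : 0 ≤ ∑ p ∈ l, D p := sum_nonneg fun p _ ↦ hD0 p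
    linarith
  have hDa : ∀ p, linesThrough A p ≠ ∅ → D p ≤ a := fun p hp ↦ by
    obtain ⟨l, hl⟩ := nonempty_iff_ne_empty.2 hp
    obtain ⟨hl, hpl⟩ := mem_filter.1 hl
    have h1 := single_le_sum (f := D) (fun p _ ↦ hD0 p) hpl
    have h2 := hu0 _ (mem_image_of_mem _ hl)
    linarith [hline l hl]
  have hsumD : ∑ p, D p = n * a := by
    simp only [D]
    rw [sum_sub_distrib, hA.sum_card_linesThrough, sum_const, card_univ, hA.card_points, hb',
      nsmul_eq_mul]
    push_cast; ring
  have hsumu : ∑ C ∈ K, u C = K.card * n - n ^ 2 + a := by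
    have h1 := sum_parallelClass h fun _ ↦ 1
    simp only [mul_one, sum_const, nsmul_eq_mul] at h1
    simp only [u]
    rw [sum_sub_distrib, sum_const, nsmul_eq_mul, ← h1, hb']
    ring
  -- Both sides of the incidence count weighted by `D` are expanded. With `K.card = n + 1 + c` the
  -- right side becomes `n²(1 + c) + na + a²`.
  have hident : ∑ p, D p ^ 2 + ∑ C ∈ K, u C ^ 2 =
      n ^ 2 * a - K.card * n * a + (n + a) * (K.card * n - n ^ 2 + a) := by
    have h1 := sum_linesThrough A D
    rw [sum_congr rfl hline, sum_parallelClass h fun C ↦ a - u C, ← hK] at h1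
    have h2 : ∀ p, ((linesThrough A p).card : ℤ) * D p = n * D p - D p ^ 2 := fun p ↦ by
      simp only [D]; ring
    have h3 : ∀ C : Finset (Finset P), (C.card : ℤ) * (a - u C) =
        n * a - (n + a) * u C + u C ^ 2 := fun C ↦ by
      simp only [u]; ring
    rw [sum_congr rfl fun p _ ↦ h2 p, sum_congr rfl fun C _ ↦ h3 C, sum_sub_distrib,
      sum_add_distrib, sum_sub_distrib, ← mul_sum, ← mul_sum, ← mul_sum, hsumD, hsumu, sum_const,
      nsmul_eq_mul] at h1
    linarith
  set z : ℤ := ∑ p, if linesThrough A p = ∅ then 1 else 0 with hz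
  have hDz : ∀ p, linesThrough A p = ∅ → D p = n := fun p hp ↦ by simp [D, hp]
  obtain ⟨c, hc⟩ : ∃ c : ℤ, (K.card : ℤ) = n + 1 + c := ⟨K.card - n - 1, by ring⟩
  have hc1 : 1 ≤ c := by zify at hk; linarith
  have haa : (a : ℤ) ≤ a ^ 2 := by exact_mod_cast Nat.le_self_pow (by norm_num) a
  rw [hc] at hident hsumu
  -- The `z` points on no line have `D = n`; all other `D`, and all `u`, are at most `a`. If `z ≤
  -- c`, the squares are too small: the identity would give `n ≤ a ^ 2`. If `z ≥ c + 1`, they are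
  -- too large: it would give `(n - 1) * c + 2 * a - 1 ≤ a ^ 2`, impossible as `a, c ≥ 1`.
  rcases le_or_gt z c with hzc | hzc
  · have h1 : ∑ p, D p ^ 2 ≤
        ∑ p, (a * D p + n * (n - a) * if linesThrough A p = ∅ then 1 else 0) := by
      refine sum_le_sum fun p _ ↦ ?_
      split_ifs with hp
      · rw [hDz p hp]; linarith
      · nlinarith [hD0 p, hDa p hp]
    rw [sum_add_distrib, ← mul_sum, ← mul_sum, ← hz, hsumD] at h1
    have h2 : ∑ C ∈ K, u C ^ 2 ≤ ∑ C ∈ K, a * u C := by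
      refine sum_le_sum fun C hC ↦ ?_
      nlinarith [hu0 C hC, hua C hC]
    rw [← mul_sum, hsumu] at h2
    have h3 : (n : ℤ) * (n - a) * z ≤ n * (n - a) * c :=
      mul_le_mul_of_nonneg_left hzc (mul_nonneg (by linarith) (by linarith))
    have h4 : (n : ℤ) * n ≤ n * a ^ 2 := by linarith
    nlinarith
  · have h1 : ∑ p, (D p + (n ^ 2 - n) * if linesThrough A p = ∅ then 1 else 0) ≤
        ∑ p, D p ^ 2 := by
      refine sum_le_sum fun p _ ↦ ?_
      split_ifs with hp
      · rw [hDz p hp]; linarith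
      · have := hD0 p
        rcases this.eq_or_lt with h0 | h0
        · simp [← h0]
        · nlinarith
    rw [sum_add_distrib, ← mul_sum, ← hz, hsumD] at h1
    have h2 : ∑ C ∈ K, (2 * u C - 1) ≤ ∑ C ∈ K, u C ^ 2 :=
      sum_le_sum fun C _ ↦ by nlinarith [sq_nonneg (u C - 1)]
    rw [sum_sub_distrib, ← mul_sum, hsumu, sum_const, nsmul_eq_mul, mul_one, hc] at h2
    have h3 : ((n : ℤ) ^ 2 - n) * (c + 1) ≤ (n ^ 2 - n) * z :=
      mul_le_mul_of_nonneg_left (by linarith) (by nlinarith)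
    have h4 : (1 : ℤ) ≤ a := by exact_mod_cast h1a
    have h5 := mul_le_mul_of_nonneg_right hc1 (show (0 : ℤ) ≤ n - 1 by linarith)
    linarith

end IsPartialAffinePlane

end ParallelClasses

/-! ### Passing between affine and projective planes. -/

section ProjectiveExtension

variable {P : Type*} [DecidableEq P] {n : ℕ} {A : Finset (Finset P)}

theorem card_disjSum_inter {α β : Type*} [DecidableEq α] [DecidableEq β] (s s' : Finset α)
    (t t' : Finset β) :
    (s.disjSum t ∩ s'.disjSum t').card = (s ∩ s').card + (t ∩ t').card := by
  rw [← card_disjSum]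
  congr 1
  ext (x | x) <;> simp

/-- A line, extended by the ideal point of its parallel class. -/
def idealExtension {n : ℕ} (A : Finset (Finset P)) (i : Finset (Finset P) → Fin (n + 1))
    (l : Finset P) : Finset (P ⊕ Fin (n + 1)) :=
  l.disjSum {i (parallelClass A l)}

/-- The line of ideal points. -/
def idealLine (P : Type*) (n : ℕ) : Finset (P ⊕ Fin (n + 1)) :=
  (∅ : Finset P).disjSum univ

theorem idealExtension_toLeft (i : Finset (Finset P) → Fin (n + 1)) (l : Finset P) :
    (idealExtension A i l).toLeft = l := by
  simp [idealExtension]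

theorem idealExtension_injective (i : Finset (Finset P) → Fin (n + 1)) :
    Function.Injective (idealExtension A i) := fun l m h ↦ by
  rw [← idealExtension_toLeft (A := A) i l, h, idealExtension_toLeft]

theorem idealLine_notMem (hn : 2 ≤ n) (i : Finset (Finset P) → Fin (n + 1)) :
    idealLine P n ∉ A.image (idealExtension A i) := by
  intro h
  obtain ⟨l, -, hl⟩ := mem_image.1 h
  have h1 := congrArg (fun s ↦ s.toRight.card) hl
  rw [idealExtension, idealLine, toRight_disjSum, toRight_disjSum, card_singleton, card_univ,
    Fintype.card_fin] at h1
  omega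

variable [Fintype P]

/-- Parallel lines now meet in the ideal point of their class, and injectivity of `i` keeps
nonparallel lines from meeting twice. Labels assigned to no class are harmless: they lie on the
ideal line only. -/
theorem IsPartialAffinePlane.isPartialProjectivePlane (hA : IsPartialAffinePlane n A)
    (h : ParallelismIsEquivalence A) {i : Finset (Finset P) → Fin (n + 1)}
    (hi : Set.InjOn i (parallelClasses A)) :
    IsPartialProjectivePlane n (insert (idealLine P n) (A.image (idealExtension A i))) where
  one_le_order := by have := hA.two_le_order; omega
  card_points := by simp [hA.card_points, add_assoc]
  card_line := by
    simp only [mem_insert, mem_image, forall_eq_or_imp, forall_exists_index, and_imp,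
      forall_apply_eq_imp_iff₂]
    refine ⟨by simp [idealLine], fun l hl ↦ ?_⟩
    simp [idealExtension, hA.card_line l hl]
  card_inter := by
    have h1 : ∀ l ∈ A, (idealLine P n ∩ idealExtension A i l).card = 1 := fun l _ ↦ by
      rw [idealLine, idealExtension, card_disjSum_inter]
      simp
    intro l hl m hm hlm
    rw [mem_insert, mem_image] at hl hm
    rcases hl with rfl | ⟨l, hl, rfl⟩ <;> rcases hm with rfl | ⟨m, hm, rfl⟩
    · exact absurd rfl hlm
    · exact h1 m hm
    · rw [inter_comm]; exact h1 l hl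
    · have hlm' : l ≠ m := fun h ↦ hlm (by rw [h])
      rw [idealExtension, idealExtension, card_disjSum_inter]
      by_cases hp : LinesParallel l m
      · rw [(parallelClass_eq_iff h hl hm).2 hp, inter_self, card_singleton,
          disjoint_iff_inter_eq_empty.1 (hp.resolve_left hlm'), card_empty]
      · have hne : i (parallelClass A l) ≠ i (parallelClass A m) := fun heq ↦
          hp ((parallelClass_eq_iff h hl hm).1
            (hi (mem_image_of_mem _ hl) (mem_image_of_mem _ hm) heq))
        rw [hA.card_inter_eq_one hl hm hp, singleton_inter_of_notMem (by simpa using hne),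
          card_empty]

/-- Removing a line with its points from a projective plane leaves an affine plane. -/
theorem IsPartialProjectivePlane.isAffinePlaneOfOrder (hn : 2 ≤ n)
    (hP : Fintype.card P = n ^ 2) {B : Finset (Finset (P ⊕ Fin (n + 1)))}
    (hB : IsPartialProjectivePlane n B) (hc : B.card = n ^ 2 + n + 1)
    (hideal : idealLine P n ∈ B) :
    IsAffinePlaneOfOrder n ((B.erase (idealLine P n)).image toLeft) := by
  have hright : ∀ l ∈ B.erase (idealLine P n), l.toRight.card = 1 := fun l hl ↦ by
    rw [mem_erase] at hl
    have h1 := hB.card_inter l hl.2 _ hideal hl.1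
    rwa [idealLine, ← toLeft_disjSum_toRight (u := l), card_disjSum_inter, inter_empty, card_empty,
      inter_univ, zero_add] at h1
  have hleft : ∀ l ∈ B.erase (idealLine P n), l.toLeft.card = n := fun l hl ↦ by
    have h1 := card_toLeft_add_card_toRight (u := l)
    rw [hright l hl, hB.card_line l (mem_erase.1 hl).2] at h1
    omega
  have hnot : ∀ {l : Finset (P ⊕ Fin (n + 1))} {p : P}, Sum.inl p ∈ l → l ≠ idealLine P n := by
    rintro l p hp rfl
    simp [idealLine] at hp
  have hline : ∀ p q : P, p ≠ q → ∃! l : Finset P,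
      l ∈ (B.erase (idealLine P n)).image toLeft ∧ p ∈ l ∧ q ∈ l := by
    intro p q hpq
    have hpq' : (Sum.inl p : P ⊕ Fin (n + 1)) ≠ Sum.inl q := fun h ↦ hpq (Sum.inl_injective h)
    obtain ⟨l, hl, hpl, hql⟩ := hB.exists_line hc hpq'
    refine ⟨l.toLeft, ⟨mem_image_of_mem _ (mem_erase.2 ⟨hnot hpl, hl⟩), by simpa, by simpa⟩, ?_⟩
    rintro m ⟨hm, hpm, hqm⟩
    obtain ⟨m, hm', rfl⟩ := mem_image.1 hm
    rw [mem_toLeft] at hpm hqm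
    rw [hB.eq_of_mem (mem_erase.1 hm').2 hl hpq' hpm hpl hqm hql]
  refine { exists_unique_line := hline, exists_unique_parallel := ?_, exists_noncollinear := ?_,
           card_points := hP, card_line := ?_ }
  · intro l₀ hl₀ p hp
    obtain ⟨l, hl, rfl⟩ := mem_image.1 hl₀
    rw [mem_toLeft] at hp
    -- The parallel through `p` is the line joining `p` to the ideal point `j` of `l`.
    obtain ⟨j, hj⟩ := card_eq_one.1 (hright l hl)
    have hjl : Sum.inr j ∈ l := by rw [← mem_toRight, hj]; simp
    obtain ⟨m, hm, hpm, hjm⟩ := hB.exists_line hc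
      (show (Sum.inl p : P ⊕ Fin (n + 1)) ≠ Sum.inr j by simp)
    refine ⟨m.toLeft, ⟨mem_image_of_mem _ (mem_erase.2 ⟨hnot hpm, hm⟩), by simpa, ?_⟩, ?_⟩
    · rw [disjoint_left]
      intro q hqm hql
      rw [mem_toLeft] at hqm hql
      have := hB.eq_of_mem hm (mem_erase.1 hl).2 (by simp) hqm hql hjm hjl
      exact hp (this ▸ hpm)
    · rintro k₀ ⟨hk₀, hpk, hkl⟩
      obtain ⟨k, hk, rfl⟩ := mem_image.1 hk₀
      rw [mem_toLeft] at hpk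
      have hne : k ≠ l := fun h ↦ hp (h ▸ hpk)
      obtain ⟨x, hx⟩ := card_eq_one.1
        (hB.card_inter k (mem_erase.1 hk).2 l (mem_erase.1 hl).2 hne)
      have hx' : x ∈ k ∩ l := by rw [hx]; simp
      rw [mem_inter] at hx'
      have hjk : Sum.inr j ∈ k := by
        rcases x with q | j'
        · exact absurd (mem_toLeft.2 hx'.2) (disjoint_left.1 hkl (mem_toLeft.2 hx'.1))
        · have h1 := mem_toRight.2 hx'.2
          rw [hj, mem_singleton] at h1
          exact h1 ▸ hx'.1
      rw [hB.eq_of_mem (mem_erase.1 hk).2 hm (by simp) hpk hpm hjk hjm]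
  · obtain ⟨p, q, hpq⟩ := Fintype.exists_pair_of_one_lt_card (α := P) (by rw [hP]; nlinarith)
    obtain ⟨l, ⟨hl, hpl, hql⟩, huniq⟩ := hline p q hpq
    obtain ⟨r, -, hr⟩ : ∃ r ∈ univ, r ∉ l := exists_mem_notMem_of_card_lt_card (by
      obtain ⟨m, hm, rfl⟩ := mem_image.1 hl
      rw [hleft m hm, card_univ, hP]
      nlinarith)
    refine ⟨p, q, r, hpq, fun h ↦ hr (h ▸ hpl), fun h ↦ hr (h ▸ hql), ?_⟩
    rintro ⟨m, hm, hpm, hqm, hrm⟩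
    exact hr (huniq m ⟨hm, hpm, hqm⟩ ▸ hrm)
  · intro l hl
    obtain ⟨m, hm, rfl⟩ := mem_image.1 hl
    exact hleft m hm

theorem IsPartialAffinePlane.canBeCompleted (hA : IsPartialAffinePlane n A)
    (h : ParallelismIsEquivalence A) {a : ℕ} (h1a : 1 ≤ a) (hb : A.card + a = n ^ 2)
    (ha : a ^ 2 < n) (hfew : IsPartialProjectivePlane.FewMissing n (n + a)) :
    CanBeCompletedToAffinePlane n A := by
  have hk := hA.card_parallelClasses_le h h1a hb ha
  have hle : (parallelClasses A : Set (Finset (Finset P))).encard ≤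
      (Set.univ : Set (Fin (n + 1))).encard := by
    rw [Set.encard_coe_eq_coe_finsetCard, ← coe_univ, Set.encard_coe_eq_coe_finsetCard, card_univ,
      Fintype.card_fin]
    exact_mod_cast hk
  obtain ⟨i, -, hi⟩ := (Finset.finite_toSet _).exists_injOn_of_encard_le hle
  have hideal := idealLine_notMem (A := A) hA.two_le_order i
  obtain ⟨B, hsub, hB, hc⟩ := (hA.isPartialProjectivePlane h hi).exists_completion
    (N := n + a) (by
      rw [card_insert_of_notMem hideal, card_image_of_injective _ (idealExtension_injective i)]
      omega) hfew
  refine ⟨(B.erase (idealLine P n)).image toLeft, fun l hl ↦ ?_,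
    hB.isAffinePlaneOfOrder hA.two_le_order hA.card_points hc (hsub (mem_insert_self _ _))⟩
  have hl' := mem_image_of_mem (idealExtension A i) hl
  exact mem_image.2 ⟨_, mem_erase.2 ⟨fun h ↦ hideal (h ▸ hl'), hsub (mem_insert_of_mem hl')⟩,
    idealExtension_toLeft i l⟩

end ProjectiveExtension

/-! ### The numerical bounds. -/

/-- The hypothesis on `a` in terms of the number of missing lines. -/
theorem fewMissing_of_lt {n a : ℕ} (hsq : a ^ 2 < n)
    (h : (a : ℝ) < (n : ℝ) ^ 2 - gMin n + 1) :
    IsPartialProjectivePlane.FewMissing n (n + a) := by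
  intro t ht
  obtain rfl : a = t + 2 := by omega
  refine ⟨hsq, ?_⟩
  suffices hs : 6 * t + 6 < n ∨ (t = 2 ∧ n = 18) by omega
  have hmin : gOne n < (n : ℝ) ^ 2 - (t + 2 : ℕ) + 1 ∨ gTwo n < (n : ℝ) ^ 2 - (t + 2 : ℕ) + 1 ∨
      gThree n < (n : ℝ) ^ 2 - (t + 2 : ℕ) + 1 ∨ gFour n < (n : ℝ) ^ 2 - (t + 2 : ℕ) + 1 := by
    have h1 : gMin n < (n : ℝ) ^ 2 - (t + 2 : ℕ) + 1 := by linarith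
    rwa [gMin, min_lt_iff, min_lt_iff, min_lt_iff, or_assoc] at h1
  -- For `t ≥ 3`, `6 * t + 6 < (t + 2) ^ 2 < n`, so `gMin` matters only for `t ≤ 2`.
  by_cases ht3 : 3 ≤ t
  · left; nlinarith
  rcases hmin with h1 | h1 | h1 | h1
  · rw [gOne] at h1
    push_cast at h1
    have : (0 : ℝ) ≤ t := t.cast_nonneg
    linarith
  · rw [gTwo] at h1
    push_cast at h1
    have h2 : ((t : ℝ) + 7) ^ 2 < 4 * (n + 3) := by
      have h3 : (t + 7 : ℝ) / 2 < √(n + 3) := by linarith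
      rw [Real.lt_sqrt (by positivity)] at h3
      linarith
    have h3 : (t + 7) ^ 2 < 4 * (n + 3) := by exact_mod_cast h2
    have : t ≤ 2 := by omega
    -- The bound gives `n ≥ 10, 14, 18` for `t = 0, 1, 2`; the last value is the source of the
    -- exceptional case `n = 18`.
    interval_cases t <;> omega
  · left
    rw [gThree] at h1
    push_cast at h1
    have h2 : (6 * t + 6 : ℝ) < n := by linarith
    exact_mod_cast h2
  · left
    rw [gFour] at h1
    push_cast at h1
    -- For `n ≤ 18` the term `17 / √5 * √n` exceeds the linear one, so no positive `a` is allowed;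
    -- and `6 * t + 6 ≤ 18` as `t ≤ 2`.
    have h18 : 18 < n := by
      by_contra! hn
      have hn' : (n : ℝ) ≤ 18 := by exact_mod_cast hn
      have h5 : √5 < 3 := by rw [Real.sqrt_lt' (by norm_num)]; norm_num
      have h5' : 0 < √(5 : ℝ) := by positivity
      have hs0 : 0 ≤ √(n : ℝ) := Real.sqrt_nonneg _
      have hs : √(n : ℝ) < 5 := by rw [Real.sqrt_lt' (by norm_num)]; linarith
      have hnn : √(n : ℝ) * √n = n := Real.mul_self_sqrt (by positivity)
      have h17 : 5 ≤ 17 / √5 := by rw [le_div_iff₀ h5']; linarith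
      have h6 : 5 * √(n : ℝ) ≤ 17 / √5 * √n := mul_le_mul_of_nonneg_right h17 hs0
      have h7 : (√5 - 1) / 2 * (n : ℝ) ≤ 1 * n :=
        mul_le_mul_of_nonneg_right (by linarith) (by positivity)
      have h8 : √(n : ℝ) * √n ≤ 5 * √n := mul_le_mul_of_nonneg_right hs.le hs0
      have : (0 : ℝ) ≤ t := t.cast_nonneg
      linarith
    omega

theorem theorem2p8 {P : Type*} [Fintype P] [DecidableEq P] (n a : ℕ) (A : Finset (Finset P))
    (hA : IsPartialAffinePlane n A) (hpar : ParallelismIsEquivalence A)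
    (hb : (A.card : ℤ) = (n : ℤ) ^ 2 - (a : ℤ)) (ha : 1 ≤ a)
    (ha' : (a : ℝ) < min (Real.sqrt (n : ℝ)) ((n : ℝ) ^ 2 - gMin n + 1)) :
    CanBeCompletedToAffinePlane n A := by
  rw [lt_min_iff, Real.lt_sqrt (by positivity)] at ha'
  have hsq : a ^ 2 < n := by exact_mod_cast ha'.1
  exact hA.canBeCompleted hpar ha (by zify; linarith) hsq (fewMissing_of_lt hsq ha'.2)
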